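/- **Notation.** For $K=\mathbb R,\mathbb C$ let $K((\frac1v))^c$ be the field of Laurent series $f=\sum_{k\ge m}a_k v^{-k}$ (finitely many positive powers of $v$) that converge for $|v|\gg0$. $\mathbb R((\frac1v))^c$ is totally ordered by $f\preceq g\iff f(v)\le g(v)$ for $v\gg0$. A *polynomial phase function* is the germ at $v=+\infty$ of a continuous real function $\phi$ with $f(v)\in\mathbb R_{>0}e^{i\pi\phi(v)}$ for $v\gg0$, for some $0\neq f\in\mathbb C((\frac1v))^c$; write $\phi\prec\psi$ (resp. $\phi\preceq\psi$) if $\phi(v)<\psi(v)$ (resp. $\le$) for $v\gg0$. Let $GL^+(2,\mathbb R((\frac1v))^c)$ be the group of $T\in GL(2,\mathbb R((\frac1v))^c)$ with $T_v\in GL^+(2,\mathbb R)$ for $v\gg0$; it acts on $\mathbb C((\frac1v))^c\cong(\mathbb R((\frac1v))^c)^2$, $f\mapsto(\mathrm{Re}f,\mathrm{Im}f)$. A lift $\widetilde{\mathrm{Pa}}(T):v\mapsto(T_v,g_v)$ of $v\mapsto T_v$ ($v\gg0$) to the universal cover of $GL^+(2,\mathbb R)$ (pairs $(T,g)$ with $g:\mathbb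 R\to\mathbb R$ increasing, $g(x+1)=g(x)+1$, and $T e^{i\pi x}\in\mathbb R_{>0}e^{i\pi g(x)}$) induces a bijection $\Gamma_T$ of the set of polynomial phase functions, $(\Gamma_T\phi)(v)=g_v(\phi(v))$. Let $\mathcal A$ be the heart of a bounded t-structure on a triangulated category $\mathcal D$ and $K(\mathcal D)$ the Grothendieck group. A homomorphism $Z:K(\mathcal D)\to\mathbb C((\frac1v))^c$ is a *polynomial stability function* on $\mathcal A$ with respect to $(\phi_0,\phi_0+1]$ ($\phi_0$ a polynomial phase function) if $Z(E)(v)\in\mathbb R_{>0}e^{i\pi(\phi_0(v),\phi_0(v)+1]}$ for $v\gg0$, for every $0\ne E\in\mathcal A$; then $\phi_Z(E)$ is the germ with $\phi_0\prec\phi_Z(E)\preceq\phi_0+1$ and $Z(E)(v)\in\mathbb R_{>0}e^{i\pi\phi_Z(E)(v)}$. A nonzero $E\in\mathcal A$ is $Z$-semistable (resp. $Z$-stable) if $\phi_Z(M)\preceq\phi_Z(N)$ (resp. $\prec$) for all short exact sequences $0\to M\to E\to N\to0$ in $\mathcal A$ with $M,N\neq0$; $E\in\mathcal D$ is $Z$-(semi)stable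 if some $E[j]$ is a $Z$-(semi)stable object of $\mathcal A$, and then $\phi_Z(E)=\phi_Z(E[j])-j$. $Z$ has the *HN property* if every nonzero $E\in\mathcal A$ has a finite filtration in $\mathcal A$ with $Z$-semistable quotients of strictly decreasing phases. The slicing is $\mathcal P(\phi)=\{Z\text{-semistable }E\in\mathcal D:\phi_Z(E)=\phi\}\cup\{0\}$; if $Z$ has the HN property, $(Z,\mathcal P)$ is called a *polynomial stability condition*. For a lifted path set $(Z,\mathcal P)\cdot\widetilde{\mathrm{Pa}}(T)=(T^{-1}Z,\ \phi\mapsto\mathcal P(\Gamma_T\phi))$, and for an exact equivalence $\Phi$ set $\Phi\cdot(Z,\mathcal P)=(Z\circ(\Phi^K)^{-1},\ \phi\mapsto\Phi(\mathcal P(\phi)))$, where $\Phi^K$ is the induced isomorphism of Grothendieck groups. For a homomorphism $S:K(\mathcal D)\to R$ to a totally ordered abelian group, a nonzero $E\in\mathcal A$ is $S$-semistable if $S(E)=0$ and $S(E')\preceq0$ for all nonzero proper subobjects $E'\subset E$ in $\mathcal A$. For a torsion pair $(\mathcal T,\mathcal F)$ in $\mathcal A$, $S$ satisfies *refinement-0*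 if all $S$-semistable objects lie in $\mathcal T$ and $S(G)\prec0$ for all $0\ne G\in\mathcal F$; it satisfies *refinement-1* if all $S$-semistable objects lie in $\mathcal F$ and $S(G)\succ0$ for all $0\neq G\in\mathcal T$. **Configuration III.** Let $\Phi:\mathcal D\to\mathcal U$, $\Psi:\mathcal U\to\mathcal D$ be exact equivalences of triangulated categories with $\Psi\Phi\cong\mathrm{id}_{\mathcal D}[-1]$, $\Phi\Psi\cong\mathrm{id}_{\mathcal U}[-1]$; let $\mathcal A,\mathcal B$ be hearts of bounded t-structures on $\mathcal D,\mathcal U$ with $\Phi\mathcal A\subset D^{[0,1]}_{\mathcal B}$; let $Z_{\mathcal A},Z_{\mathcal B}$ be polynomial stability functions on $\mathcal A,\mathcal B$ with respect to $(a,a+1]$, $(b,b+1]$, with phases $\phi_{\mathcal A},\phi_{\mathcal B}$; let $T\in GL^+(2,\mathbb R((\frac1v))^c)$ with $Z_{\mathcal B}(\Phi E)=T\,Z_{\mathcal A}(E)$ for all $E\in\mathcal D$, and let a lifted path $\widetilde{\mathrm{Pa}}(T)$ be chosen whose $\Gamma_T$ satisfies $a\prec\Gamma_T^{-1}(b)\prec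 a+1$. An object $E$ is $\Phi_{\mathcal B}$-WIT$_i$ if $\Phi E\in\mathcal B[-i]$ up to isomorphism; $W_i\subset\mathcal A$ is the full subcategory of $\Phi_{\mathcal B}$-WIT$_i$ objects. The HN property is not assumed. **Theorem.** In Configuration III: 1. $\Gamma_T^{-1}(b)\prec\phi_{\mathcal A}(E)$ for every nonzero $\Phi_{\mathcal B}$-WIT$_0$ object $E\in\mathcal A$, and $\phi_{\mathcal A}(F)\preceq\Gamma_T^{-1}(b)$ for every nonzero $\Phi_{\mathcal B}$-WIT$_1$ object $F\in\mathcal A$. 2. Every nonzero $Z_{\mathcal A}$-semistable object of $\mathcal A$ is $\Phi_{\mathcal B}$-WIT$_0$ or $\Phi_{\mathcal B}$-WIT$_1$. 3. $(W_0,W_1)$ is a torsion pair in $\mathcal A$, and $e^{i\pi(-a)}$ lies in $\mathbb C((\frac1v))^c$. Let $M\in\mathcal A$ be a nonzero $\Phi_{\mathcal B}$-WIT$_i$ object, $i\in\{0,1\}$, put $Z'=e^{i\pi(-a)}Z_{\mathcal A}$, and define $S:K(\mathcal D)\to\mathbb R((\frac1v))^c$ by $S(E)=-(\mathrm{Im}\,Z'(M))(\mathrm{Re}\,Z'(E))+(\mathrm{Re}\,Z'(M))(\mathrm{Im}\,Z'(E))$.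 Then $S$ satisfies refinement-$i$ with respect to $(W_0,W_1)$. 4. A nonzero object $E\in\mathcal A$ is $Z_{\mathcal A}$-semistable if and only if $\Phi E$ is $Z_{\mathcal B}$-semistable, and $E$ is $Z_{\mathcal A}$-stable if and only if $\Phi E$ is $Z_{\mathcal B}$-stable. 5. Suppose that $Z_{\mathcal A}$ and $Z_{\mathcal B}$ have the HN property, and let $\mathcal P_{\mathcal A},\mathcal P_{\mathcal B}$ be their slicings. Then $\Phi\cdot(Z_{\mathcal A},\mathcal P_{\mathcal A})=(Z_{\mathcal B},\mathcal P_{\mathcal B})\cdot\widetilde{\mathrm{Pa}}(T)$, and this is a polynomial stability condition on $\mathcal U$. -/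

import Mathlib

open CategoryTheory CategoryTheory.Limits CategoryTheory.Triangulated CategoryTheory.Pretriangulated
open Filter Topology ZeroObject

noncomputable section

namespace PolyStab

/-! ### Convergent Laurent series -/

section Laurent

variable {K : Type} [RCLike K]

/-- The Laurent series `∑ aₖ wᵏ` converges at the point `w`. -/
def ConvergesAt (f : LaurentSeries K) (w : K) : Prop :=
  Summable fun k : ℤ => f.coeff k * w ^ k

/-- The Laurent series converges on some punctured disk `0 < |w| < r`. -/
def IsConvergent (f : LaurentSeries K) : Prop :=
  ∃ r : ℝ, 0 < r ∧ ∀ w : K, w ≠ 0 → ‖w‖ < r → ConvergesAt f w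

theorem mul_hasSum {f g : LaurentSeries K} {w : K} (hw : w ≠ 0)
    (hf : ConvergesAt f w) (hg : ConvergesAt g w) :
    HasSum (fun k : ℤ => (f * g).coeff k * w ^ k)
      ((∑' k : ℤ, f.coeff k * w ^ k) * ∑' k : ℤ, g.coeff k * w ^ k) := by
  have hs := summable_mul_of_summable_norm hf.norm hg.norm
  have hm := tsum_mul_tsum_of_summable_norm hf.norm hg.norm
  let e : ℤ × ℤ ≃ ℤ × ℤ :=
    { toFun := fun p => (p.2, p.1 - p.2)
      invFun := fun p => (p.1 + p.2, p.1)
      left_inv := fun p => by simp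
      right_inv := fun p => by simp }
  rw [hm]
  have h1 := (e.hasSum_iff
    (f := fun z : ℤ × ℤ => f.coeff z.1 * w ^ z.1 * (g.coeff z.2 * w ^ z.2))).2 hs.hasSum
  refine h1.prod_fiberwise fun k => ?_
  rw [HahnSeries.coeff_mul, Finset.sum_mul]
  set s := Finset.antidiagonal f.isPWO_support g.isPWO_support k with hsd
  have hinj : Set.InjOn Prod.fst (s : Set (ℤ × ℤ)) := by
    intro p hp q hq h
    have hp' := (Finset.mem_antidiagonal.1 hp).2.2
    have hq' := (Finset.mem_antidiagonal.1 hq).2.2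
    ext
    · exact h
    · omega
  have : ∑ ij ∈ s, f.coeff ij.1 * g.coeff ij.2 * w ^ k
      = ∑ i ∈ s.image Prod.fst, (f.coeff i * w ^ i * (g.coeff (k - i) * w ^ (k - i))) := by
    rw [Finset.sum_image hinj]
    refine Finset.sum_congr rfl fun p hp => ?_
    have hp' := (Finset.mem_antidiagonal.1 hp).2.2
    have : k - p.1 = p.2 := by omega
    rw [this, ← hp', zpow_add₀ hw]; ring
  rw [this]
  refine hasSum_sum_of_ne_finset_zero fun i hi => ?_
  dsimp [e]
  by_contra hne
  apply hi
  rw [Finset.mem_image]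
  refine ⟨(i, k - i), Finset.mem_antidiagonal.2 ⟨?_, ?_, by simp⟩, rfl⟩
  · rw [HahnSeries.mem_support]; intro h0; simp [h0] at hne
  · rw [HahnSeries.mem_support]; intro h0; simp [h0] at hne

theorem convergesAt_single (m : ℤ) (a : K) (w : K) :
    HasSum (fun k : ℤ => (HahnSeries.single m a : LaurentSeries K).coeff k * w ^ k)
      (a * w ^ m) := by
  have := hasSum_single (f := fun k : ℤ => (HahnSeries.single m a : LaurentSeries K).coeff k * w ^ k)
    m (fun k hk => by rw [HahnSeries.coeff_single_of_ne hk, zero_mul])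
  simpa using this

variable (K) in
/-- The ring `K((w))ᶜ` of convergent Laurent series in `w = 1/v`, inside the field of formal
Laurent series with finitely many negative powers of `w`. -/
def ConvLaurent : Subring (LaurentSeries K) where
  carrier := {f | IsConvergent f}
  zero_mem' := ⟨1, one_pos, fun w _ _ => by simp [ConvergesAt, summable_zero]⟩
  one_mem' := ⟨1, one_pos, fun w _ _ => (convergesAt_single 0 1 w).summable⟩
  add_mem' := by
    rintro f g ⟨r, hr, hf⟩ ⟨s, hs, hg⟩
    refine ⟨min r s, lt_min hr hs, fun w hw h => ?_⟩
    have := (hf w hw (h.trans_le (min_le_left _ _))).add (hg w hw (h.trans_le (min_le_right _ _)))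
    simpa [ConvergesAt, add_mul] using this
  neg_mem' := by
    rintro f ⟨r, hr, hf⟩
    refine ⟨r, hr, fun w hw h => ?_⟩
    simpa [ConvergesAt] using (hf w hw h).neg
  mul_mem' := by
    rintro f g ⟨r, hr, hf⟩ ⟨s, hs, hg⟩
    exact ⟨min r s, lt_min hr hs, fun w hw h => (mul_hasSum hw
      (hf w hw (h.trans_le (min_le_left _ _))) (hg w hw (h.trans_le (min_le_right _ _)))).summable⟩

/-- The value `f(v) = ∑ aₖ (1/v)ᵏ` at a real number `v` (meaningful for `v ≫ 0`). -/
def ev (f : ConvLaurent K) (v : ℝ) : K :=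
  ∑' k : ℤ, (f : LaurentSeries K).coeff k * (((v⁻¹ : ℝ) : K)) ^ k

theorem eventually_convergesAt (f : ConvLaurent K) :
    ∀ᶠ v : ℝ in atTop, 0 < v ∧ ((v⁻¹ : ℝ) : K) ≠ 0 ∧
      ConvergesAt (f : LaurentSeries K) ((v⁻¹ : ℝ) : K) := by
  obtain ⟨r, hr, hf⟩ := f.2
  filter_upwards [eventually_gt_atTop 0, eventually_gt_atTop r⁻¹] with v hv hvr
  have h0 : ((v⁻¹ : ℝ) : K) ≠ 0 := by
    rw [Ne, RCLike.ofReal_eq_zero]; positivity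
  refine ⟨hv, h0, hf _ h0 ?_⟩
  rw [RCLike.norm_ofReal, abs_of_pos (by positivity)]
  exact inv_lt_of_inv_lt₀ hr hvr

theorem ev_zero (v : ℝ) : ev (0 : ConvLaurent K) v = 0 := by simp [ev]

theorem ev_add (f g : ConvLaurent K) : ∀ᶠ v in atTop, ev (f + g) v = ev f v + ev g v := by
  filter_upwards [eventually_convergesAt f, eventually_convergesAt g] with v hf hg
  have := hf.2.2.hasSum.add hg.2.2.hasSum
  rw [ev, ev, ev, ← this.tsum_eq]
  simp [add_mul]

theorem ev_neg (f : ConvLaurent K) (v : ℝ) : ev (-f) v = -ev f v := by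
  simp [ev, tsum_neg]

theorem ev_mul (f g : ConvLaurent K) : ∀ᶠ v in atTop, ev (f * g) v = ev f v * ev g v := by
  filter_upwards [eventually_convergesAt f, eventually_convergesAt g] with v hf hg
  exact (mul_hasSum hf.2.1 hf.2.2 hg.2.2).tsum_eq

/-- Leading term: `f(v) (1/v)⁻ᵐ` tends to the leading coefficient of `f`. -/
theorem tendsto_leading {f : ConvLaurent K} (hf : f ≠ 0) :
    ∃ (m : ℤ) (a : K), a ≠ 0 ∧
      Tendsto (fun v : ℝ => ev f v * (((v⁻¹ : ℝ) : K)) ^ (-m)) atTop (𝓝 a) := by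
  have hf' : (f : LaurentSeries K) ≠ 0 := fun h => hf (Subtype.ext h)
  set F : LaurentSeries K := (f : LaurentSeries K) with hF
  obtain ⟨r, hr, hc⟩ := f.2
  refine ⟨F.order, F.coeff F.order, HahnSeries.coeff_order_eq_zero.not.2 hf', ?_⟩
  have hinj : Function.Injective (fun n : ℕ => F.order + (n : ℤ)) := fun a b h => by
    simpa using h
  set ρ : ℝ := r / 2 with hρ
  have hρ0 : 0 < ρ := by positivity
  have hρK : ((ρ : ℝ) : K) ≠ 0 := by rw [Ne, RCLike.ofReal_eq_zero]; exact hρ0.ne'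
  have hsum : Summable fun n : ℕ => ‖F.coeff (F.order + n)‖ * ρ ^ n := by
    have h1 := (hc (ρ : K) hρK (by
      rw [RCLike.norm_ofReal, abs_of_pos hρ0]; linarith)).norm.comp_injective hinj
    have h2 := h1.mul_right (ρ ^ (-F.order))
    refine h2.congr fun n => ?_
    simp only [Function.comp, norm_mul, norm_zpow, RCLike.norm_ofReal, abs_of_pos hρ0]
    rw [mul_assoc, ← zpow_add₀ hρ0.ne', ← zpow_natCast]
    congr 2; ring
  have key : Tendsto (fun w : ℝ => ∑' n : ℕ, F.coeff (F.order + n) * ((w : ℝ) : K) ^ n) (𝓝[>] 0)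
      (𝓝 (∑' n : ℕ, F.coeff (F.order + n) * (0 : K) ^ n)) := by
    refine tendsto_tsum_of_dominated_convergence hsum (fun n => ?_) ?_
    · have : Continuous fun w : ℝ => F.coeff (F.order + n) * ((w : ℝ) : K) ^ n := by
        have := RCLike.continuous_ofReal (K := K)
        fun_prop
      have h := (this.tendsto 0).mono_left (nhdsWithin_le_nhds (s := Set.Ioi (0 : ℝ)))
      simpa using h
    · have : Set.Ioo (0 : ℝ) ρ ∈ 𝓝[>] (0 : ℝ) := Ioo_mem_nhdsGT hρ0
      filter_upwards [this] with w hw n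
      rw [norm_mul, norm_pow, RCLike.norm_ofReal, abs_of_pos hw.1]
      gcongr
      exacts [hw.1.le, hw.2.le]
  have h0 : (∑' n : ℕ, F.coeff (F.order + n) * (0 : K) ^ n) = F.coeff F.order := by
    rw [tsum_eq_single 0 (fun n hn => by simp [hn])]; simp
  rw [h0] at key
  refine (key.comp tendsto_inv_atTop_nhdsGT_zero).congr' ?_
  filter_upwards [eventually_convergesAt f] with v hv
  simp only [Function.comp]
  rw [ev, ← hF, ← tsum_mul_right, ← hinj.tsum_eq]
  · refine tsum_congr fun n => ?_
    rw [mul_assoc, ← zpow_add₀ hv.2.1, ← zpow_natCast]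
    congr 2; ring
  · intro k hk
    rw [Function.mem_support] at hk
    have : F.coeff k ≠ 0 := fun h => hk (by simp [h])
    have := HahnSeries.order_le_of_coeff_ne_zero this
    exact ⟨(k - F.order).toNat, by simp [Int.toNat_of_nonneg (sub_nonneg.2 this)]⟩

/-- The germ at `v = +∞` of `v ↦ f(v)`. -/
def evGerm (f : ConvLaurent K) : Germ (atTop : Filter ℝ) K := ((ev f : ℝ → K) : Germ _ K)

end Laurent

theorem eventually_sign {f : ConvLaurent ℝ} (hf : f ≠ 0) :
    (∀ᶠ v in atTop, 0 < ev f v) ∨ ∀ᶠ v in atTop, ev f v < 0 := by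
  obtain ⟨m, a, ha, h⟩ := tendsto_leading hf
  rcases lt_or_gt_of_ne ha with ha | ha
  · right
    filter_upwards [h.eventually (gt_mem_nhds ha), eventually_gt_atTop 0] with v h1 h2
    have : (0 : ℝ) < (v⁻¹) ^ (-m) := by positivity
    exact neg_of_mul_neg_left h1 this.le
  · left
    filter_upwards [h.eventually (lt_mem_nhds ha), eventually_gt_atTop 0] with v h1 h2
    have : (0 : ℝ) < (v⁻¹) ^ (-m) := by positivity
    exact (pos_iff_pos_of_mul_pos h1).2 this

/-- The total order on `ℝ((1/v))ᶜ`: `f ≼ g` iff `f(v) ≤ g(v)` for `v ≫ 0`. -/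
instance : LinearOrder (ConvLaurent ℝ) :=
  { le := fun f g => ∀ᶠ v in atTop, ev f v ≤ ev g v
    le_refl := fun f => Eventually.of_forall fun v => le_rfl
    le_trans := fun f g h h1 h2 => by
      filter_upwards [h1, h2] with v a b using a.trans b
    le_antisymm := fun f g h1 h2 => by
      by_contra hne
      have hs := ev_add f (-g)
      rcases eventually_sign (sub_ne_zero.2 hne) with h | h
      · obtain ⟨v, a, b, c, d⟩ := (h.and (h1.and (h2.and hs))).exists
        rw [← sub_eq_add_neg, ev_neg] at d
        linarith
      · obtain ⟨v, a, b, c, d⟩ := (h.and (h1.and (h2.and hs))).exists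
        rw [← sub_eq_add_neg, ev_neg] at d
        linarith
    le_total := fun f g => by
      by_cases hne : f = g
      · exact Or.inl (Eventually.of_forall fun v => by rw [hne])
      have hs := ev_add f (-g)
      rcases eventually_sign (sub_ne_zero.2 hne) with h | h
      · right
        filter_upwards [h, hs] with v a d
        rw [← sub_eq_add_neg, ev_neg] at d
        linarith
      · left
        filter_upwards [h, hs] with v a d
        rw [← sub_eq_add_neg, ev_neg] at d
        linarith
    toDecidableLE := Classical.decRel _ }

instance : IsOrderedAddMonoid (ConvLaurent ℝ) where
  add_le_add_left := fun f g h k => by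
    have h' : ∀ᶠ v in atTop, ev f v ≤ ev g v := h
    change ∀ᶠ v in atTop, ev (f + k) v ≤ ev (g + k) v
    filter_upwards [h', ev_add f k, ev_add g k] with v a b c
    rw [b, c]; linarith

/-! ### `ℂ((1/v))ᶜ` as a plane over `ℝ((1/v))ᶜ` -/

theorem map_convergent {K L : Type} [RCLike K] [RCLike L] (f : LaurentSeries K)
    (hf : IsConvergent f) (g : LaurentSeries L) (h : ∀ k, ‖g.coeff k‖ ≤ ‖f.coeff k‖) :
    IsConvergent g := by
  obtain ⟨r, hr, hc⟩ := hf
  refine ⟨r, hr, fun w hw hwr => ?_⟩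
  have h1 := (hc ((‖w‖ : ℝ) : K) (by simpa using hw)
    (by simpa using hwr)).norm
  refine Summable.of_norm_bounded h1 fun k => ?_
  simp only [norm_mul, norm_zpow, RCLike.norm_ofReal, abs_norm]
  gcongr
  exact h k

/-- The real part, coefficientwise (that is, the real part of the values at real `v`). -/
def reL : ConvLaurent ℂ →+ ConvLaurent ℝ where
  toFun f := ⟨(f : LaurentSeries ℂ).map Complex.reAddGroupHom,
    map_convergent _ f.2 _ fun k => Complex.abs_re_le_norm _⟩
  map_zero' := by ext; simp
  map_add' f g := by ext; simp

/-- The imaginary part, coefficientwise. -/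
def imL : ConvLaurent ℂ →+ ConvLaurent ℝ where
  toFun f := ⟨(f : LaurentSeries ℂ).map Complex.imAddGroupHom,
    map_convergent _ f.2 _ fun k => Complex.abs_im_le_norm _⟩
  map_zero' := by ext; simp
  map_add' f g := by ext; simp

/-- A real convergent Laurent series regarded as a complex one. -/
def ofRealL : ConvLaurent ℝ →+ ConvLaurent ℂ where
  toFun f := ⟨(f : LaurentSeries ℝ).map Complex.ofRealHom,
    map_convergent _ f.2 _ fun k => by simp⟩
  map_zero' := by ext; simp
  map_add' f g := by ext; simp

/-- The constant Laurent series `i`. -/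
def iL : ConvLaurent ℂ :=
  ⟨HahnSeries.single 0 Complex.I, 1, one_pos,
    fun w _ _ => (convergesAt_single 0 Complex.I w).summable⟩

/-- The `ℝ((1/v))ᶜ`-linear action of a `2 × 2` matrix on `ℂ((1/v))ᶜ`, identified with the column
vectors `(Re f, Im f)`. -/
def matAct (T : Matrix (Fin 2) (Fin 2) (ConvLaurent ℝ)) : ConvLaurent ℂ →+ ConvLaurent ℂ :=
  AddMonoidHom.mk'
    (fun f => ofRealL (T 0 0 * reL f + T 0 1 * imL f) + iL * ofRealL (T 1 0 * reL f + T 1 1 * imL f))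
    (fun f g => by simp only [map_add, mul_add]; abel)

theorem reL_add_iL (a b : ConvLaurent ℝ) : reL (ofRealL a + iL * ofRealL b) = a := by
  apply Subtype.ext
  ext k
  change (((ofRealL a : LaurentSeries ℂ) + (iL : LaurentSeries ℂ) *
    (ofRealL b : LaurentSeries ℂ)).coeff k).re = _
  rw [HahnSeries.coeff_add, iL, HahnSeries.coeff_single_zero_mul]
  simp [ofRealL]

theorem imL_add_iL (a b : ConvLaurent ℝ) : imL (ofRealL a + iL * ofRealL b) = b := by
  apply Subtype.ext
  ext k
  change (((ofRealL a : LaurentSeries ℂ) + (iL : LaurentSeries ℂ) *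
    (ofRealL b : LaurentSeries ℂ)).coeff k).im = _
  rw [HahnSeries.coeff_add, iL, HahnSeries.coeff_single_zero_mul]
  simp [ofRealL]

theorem re_add_im (f : ConvLaurent ℂ) : ofRealL (reL f) + iL * ofRealL (imL f) = f := by
  apply Subtype.ext
  ext k
  change ((ofRealL (reL f) : LaurentSeries ℂ) + (iL : LaurentSeries ℂ) *
    (ofRealL (imL f) : LaurentSeries ℂ)).coeff k = _
  rw [HahnSeries.coeff_add, iL, HahnSeries.coeff_single_zero_mul]
  apply Complex.ext <;> simp [ofRealL, reL, imL]

theorem matAct_mul (S T : Matrix (Fin 2) (Fin 2) (ConvLaurent ℝ)) (f : ConvLaurent ℂ) :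
    matAct (S * T) f = matAct S (matAct T f) := by
  simp only [matAct, AddMonoidHom.mk'_apply, reL_add_iL, imL_add_iL, Matrix.mul_apply,
    Fin.sum_univ_two]
  congr 2
  · ring
  · congr 1; ring

theorem matAct_one (f : ConvLaurent ℂ) : matAct 1 f = f := by
  simp [matAct, re_add_im]

/-- The action of a real `2 × 2` matrix on `ℂ = ℝ²`. -/
def matC (M : Matrix (Fin 2) (Fin 2) ℝ) (z : ℂ) : ℂ :=
  ⟨M 0 0 * z.re + M 0 1 * z.im, M 1 0 * z.re + M 1 1 * z.im⟩

/-- The real matrix `T_v`. -/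
def evMat (T : Matrix (Fin 2) (Fin 2) (ConvLaurent ℝ)) (v : ℝ) : Matrix (Fin 2) (Fin 2) ℝ :=
  fun i j => ev (T i j) v

theorem ev_re (f : ConvLaurent ℂ) : ∀ᶠ v in atTop, ev (reL f) v = (ev f v).re := by
  filter_upwards [eventually_convergesAt f] with v hv
  rw [ev, ev, Complex.re_tsum hv.2.2]
  refine tsum_congr fun k => ?_
  have : (((v⁻¹ : ℝ) : ℂ)) ^ k = ((v⁻¹ ^ k : ℝ) : ℂ) := by push_cast; rfl
  simp only [Complex.coe_algebraMap] at *
  erw [this]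
  rw [Complex.re_mul_ofReal]
  rfl

theorem ev_im (f : ConvLaurent ℂ) : ∀ᶠ v in atTop, ev (imL f) v = (ev f v).im := by
  filter_upwards [eventually_convergesAt f] with v hv
  rw [ev, ev, Complex.im_tsum hv.2.2]
  refine tsum_congr fun k => ?_
  have : (((v⁻¹ : ℝ) : ℂ)) ^ k = ((v⁻¹ ^ k : ℝ) : ℂ) := by push_cast; rfl
  erw [this]
  rw [Complex.im_mul_ofReal]
  rfl

theorem ev_ofReal (f : ConvLaurent ℝ) (v : ℝ) : ev (ofRealL f) v = ((ev f v : ℝ) : ℂ) := by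
  rw [ev, ev, Complex.ofReal_tsum]
  refine tsum_congr fun k => ?_
  push_cast
  rfl

theorem ev_iL (v : ℝ) : ev iL v = Complex.I := by
  have := (convergesAt_single 0 Complex.I (((v⁻¹ : ℝ) : ℂ))).tsum_eq
  rw [zpow_zero, mul_one] at this
  exact this

theorem ev_matAct (T : Matrix (Fin 2) (Fin 2) (ConvLaurent ℝ)) (f : ConvLaurent ℂ) :
    ∀ᶠ v in atTop, ev (matAct T f) v = matC (evMat T v) (ev f v) := by
  filter_upwards [ev_add (ofRealL (T 0 0 * reL f + T 0 1 * imL f))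
      (iL * ofRealL (T 1 0 * reL f + T 1 1 * imL f)),
    ev_mul iL (ofRealL (T 1 0 * reL f + T 1 1 * imL f)),
    ev_add (T 0 0 * reL f) (T 0 1 * imL f), ev_add (T 1 0 * reL f) (T 1 1 * imL f),
    ev_mul (T 0 0) (reL f), ev_mul (T 0 1) (imL f), ev_mul (T 1 0) (reL f),
    ev_mul (T 1 1) (imL f), ev_re f, ev_im f] with v h1 h2 h3 h4 h5 h6 h7 h8 h9 h10
  change ev (ofRealL (T 0 0 * reL f + T 0 1 * imL f) +
    iL * ofRealL (T 1 0 * reL f + T 1 1 * imL f)) v = _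
  rw [h1, h2, ev_ofReal, ev_ofReal, ev_iL, h3, h4, h5, h6, h7, h8, h9, h10]
  apply Complex.ext <;> simp [matC, evMat]

/-! ### Polynomial phase functions -/

/-- `z ∈ ℝ_{>0} · e^{iπθ}`. -/
def OnRay (z : ℂ) (θ : ℝ) : Prop :=
  ∃ c : ℝ, 0 < c ∧ z = c * Complex.exp (Real.pi * θ * Complex.I)

theorem OnRay.ne_zero {z : ℂ} {θ : ℝ} (h : OnRay z θ) : z ≠ 0 := by
  obtain ⟨c, hc, rfl⟩ := h
  simp [hc.ne', Complex.exp_ne_zero]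

theorem onRay_arg {z : ℂ} (hz : z ≠ 0) : OnRay z (Complex.arg z / Real.pi) := by
  refine ⟨‖z‖, norm_pos_iff.2 hz, ?_⟩
  have h : (Real.pi : ℂ) * ((Complex.arg z / Real.pi : ℝ) : ℂ) = Complex.arg z := by
    push_cast
    field_simp
  rw [h, Complex.norm_mul_exp_arg_mul_I]

theorem OnRay.add_even {z : ℂ} {θ : ℝ} (h : OnRay z θ) (k : ℤ) : OnRay z (θ + 2 * k) := by
  obtain ⟨c, hc, rfl⟩ := h
  refine ⟨c, hc, ?_⟩
  congr 1
  rw [Complex.exp_eq_exp_iff_exists_int]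
  exact ⟨-k, by push_cast; ring⟩

theorem OnRay.exists_int {z : ℂ} {θ θ' : ℝ} (h : OnRay z θ) (h' : OnRay z θ') :
    ∃ k : ℤ, θ' = θ + 2 * k := by
  obtain ⟨c, hc, rfl⟩ := h
  obtain ⟨d, hd, hz⟩ := h'
  have hn := congrArg norm hz
  have e1 : ∀ t : ℝ, ‖Complex.exp (Real.pi * t * Complex.I)‖ = 1 := fun t => by
    have := Complex.norm_exp_ofReal_mul_I (Real.pi * t)
    rwa [Complex.ofReal_mul] at this
  rw [norm_mul, norm_mul, e1, e1, Complex.norm_real, Complex.norm_real, mul_one, mul_one,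
    Real.norm_of_nonneg hc.le, Real.norm_of_nonneg hd.le] at hn
  subst hn
  have hc' : (c : ℂ) ≠ 0 := by exact_mod_cast hc.ne'
  obtain ⟨n, hn⟩ := Complex.exp_eq_exp_iff_exists_int.1 (mul_left_cancel₀ hc' hz)
  refine ⟨-n, ?_⟩
  have hpi : (Real.pi : ℂ) * Complex.I ≠ 0 :=
    mul_ne_zero (by exact_mod_cast Real.pi_ne_zero) Complex.I_ne_zero
  have : (θ : ℂ) = θ' + 2 * n := by
    apply mul_right_cancel₀ hpi
    linear_combination hn
  have h2 : θ = θ' + 2 * n := by exact_mod_cast this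
  push_cast
  linarith

/-- Germs at `v = +∞` of real-valued functions of `v`. The relation `≤` of Mathlib on germs is
`φ(v) ≤ ψ(v)` for `v ≫ 0`. -/
abbrev RealGerm : Type := Germ (atTop : Filter ℝ) ℝ

/-- `φ ≺ ψ` iff `φ(v) < ψ(v)` for `v ≫ 0`. -/
def Prec (φ ψ : RealGerm) : Prop := φ.LiftRel (· < ·) ψ

infix:50 " ≺ " => Prec

/-- A polynomial phase function: the germ of a continuous function `p` such that
`f(v) ∈ ℝ_{>0} e^{iπ p(v)}` for `v ≫ 0`, for some nonzero `f ∈ ℂ((1/v))ᶜ`. -/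
def IsPolyPhase (φ : RealGerm) : Prop :=
  ∃ p : ℝ → ℝ, ((p : ℝ → ℝ) : RealGerm) = φ ∧ (∃ r : ℝ, ContinuousOn p (Set.Ioi r)) ∧
    ∃ f : ConvLaurent ℂ, f ≠ 0 ∧ ∀ᶠ v in atTop, OnRay (ev f v) (p v)

/-- The set of all polynomial phase functions. -/
def PhaseFn : Type := {φ : RealGerm // IsPolyPhase φ}

instance : CoeOut PhaseFn RealGerm := ⟨Subtype.val⟩

/-! ### The universal cover of `GL⁺(2, ℝ)` and lifted paths -/

/-- The universal cover of `GL⁺(2, ℝ)`: pairs `(T, g)` with `T ∈ GL⁺(2, ℝ)` and `g : ℝ → ℝ`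
increasing, `g(x + 1) = g(x) + 1`, inducing the same map on `(ℝ² ∖ 0)/ℝ_{>0} = ℝ/2ℤ`. -/
structure GLTilde where
  lin : Matrix.GLPos (Fin 2) ℝ
  g : C(ℝ, ℝ)
  strictMono : StrictMono g
  map_add_one : ∀ x, g (x + 1) = g x + 1
  compat : ∀ x : ℝ,
    OnRay (matC (lin : GL (Fin 2) ℝ) (Complex.exp (Real.pi * x * Complex.I))) (g x)

instance : TopologicalSpace GLTilde :=
  TopologicalSpace.induced (fun x => (x.lin, x.g)) inferInstance

namespace GLTilde

theorem continuous_g : Continuous GLTilde.g :=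
  continuous_snd.comp (continuous_induced_dom (f := fun x : GLTilde => (x.lin, x.g)))

theorem map_add_nat (x : GLTilde) (t : ℝ) (n : ℕ) : x.g (t + n) = x.g t + n := by
  induction n with
  | zero => simp
  | succ n ih => rw [Nat.cast_succ, ← add_assoc, x.map_add_one, ih, add_assoc]

theorem surjective (x : GLTilde) : Function.Surjective x.g := by
  refine x.g.continuous.surjective ?_ ?_
  · refine tendsto_atTop_mono' _ ?_ (tendsto_natCast_atTop_atTop.comp
      (tendsto_nat_floor_atTop (α := ℝ)) |>.atTop_add (tendsto_const_nhds (x := x.g 0)))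
    filter_upwards [eventually_ge_atTop 0] with t ht
    have h := x.map_add_nat 0 ⌊t⌋₊
    have h2 := x.strictMono.monotone (Nat.floor_le ht)
    rw [zero_add] at h
    simp only [Function.comp]
    linarith
  · refine tendsto_atBot.2 fun b => ?_
    obtain ⟨n, hn⟩ := exists_nat_ge (x.g 0 - b)
    filter_upwards [eventually_le_atBot (-(n : ℝ))] with t ht
    have h := x.map_add_nat (-(n : ℝ)) n
    have h2 := x.strictMono.monotone ht
    rw [neg_add_cancel] at h
    linarith

/-- The map `g` as a bijection of `ℝ`. -/
def gEquiv (x : GLTilde) : ℝ ≃ ℝ := Equiv.ofBijective x.g ⟨x.strictMono.injective, x.surjective⟩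

theorem map_add_int (x : GLTilde) (t : ℝ) (k : ℤ) : x.g (t + k) = x.g t + k := by
  obtain ⟨n, rfl | rfl⟩ := k.eq_nat_or_neg
  · simpa using x.map_add_nat t n
  · have := x.map_add_nat (t + ((-(n : ℤ) : ℤ) : ℝ)) n
    push_cast at this ⊢
    rw [neg_add_cancel_right] at this
    linarith

theorem onRay (x : GLTilde) {z : ℂ} {θ : ℝ} (h : OnRay z θ) :
    OnRay (matC (x.lin : GL (Fin 2) ℝ) z) (x.g θ) := by
  obtain ⟨c, hc, rfl⟩ := h
  obtain ⟨d, hd, h⟩ := x.compat θ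
  refine ⟨c * d, mul_pos hc hd, ?_⟩
  rw [Complex.ofReal_mul, mul_assoc (c : ℂ), ← h]
  apply Complex.ext <;> simp [matC] <;> ring

end GLTilde

/-- The group `GL⁺(2, ℝ((1/v))ᶜ)`: those `T ∈ GL(2, ℝ((1/v))ᶜ)` with `T_v ∈ GL⁺(2, ℝ)` for
`v ≫ 0`. -/
def GLPlus : Set (GL (Fin 2) (ConvLaurent ℝ)) :=
  {T | ∀ᶠ v in atTop, 0 < (evMat (T : Matrix (Fin 2) (Fin 2) (ConvLaurent ℝ)) v).det}

/-- A lift `[v₁, ∞) → GL⁺(2, ℝ)~, v ↦ (T_v, g_v)` of the path `v ↦ T_v` to the universal cover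
(the values of `path` to the left of `v₁` are irrelevant). -/
structure LiftedPath (T : GL (Fin 2) (ConvLaurent ℝ)) where
  v₁ : ℝ
  v₁_pos : 0 < v₁
  path : ℝ → GLTilde
  continuousOn : ContinuousOn path (Set.Ici v₁)
  lift : ∀ v, v₁ ≤ v → ((path v).lin : GL (Fin 2) ℝ) =
    evMat (T : Matrix (Fin 2) (Fin 2) (ConvLaurent ℝ)) v

namespace LiftedPath

variable {T : GL (Fin 2) (ConvLaurent ℝ)} (p : LiftedPath T)

theorem continuousOn_g : ContinuousOn (fun v => (p.path v).g) (Set.Ici p.v₁) :=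
  GLTilde.continuous_g.comp_continuousOn p.continuousOn

theorem onRay_matAct {f : ConvLaurent ℂ} {q : ℝ → ℝ} (h : ∀ᶠ v in atTop, OnRay (ev f v) (q v)) :
    ∀ᶠ v in atTop,
      OnRay (ev (matAct (T : Matrix (Fin 2) (Fin 2) (ConvLaurent ℝ)) f) v)
        ((p.path v).g (q v)) := by
  filter_upwards [h, ev_matAct (T : Matrix (Fin 2) (Fin 2) (ConvLaurent ℝ)) f,
    eventually_ge_atTop p.v₁] with v h1 h2 h3
  rw [h2, ← p.lift v h3]
  exact (p.path v).onRay h1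

/-- The induced bijection `Γ_T` of the set of polynomial phase functions,
`(Γ_T φ)(v) = g_v(φ(v))` for `v ≫ 0`. -/
def Γ : PhaseFn ≃ PhaseFn where
  toFun φ := ⟨Germ.map₂ (fun x t => x.g t) (p.path : Germ atTop GLTilde) φ.1, by
    obtain ⟨_, q, rfl, ⟨r, hr⟩, f, hf, h⟩ := φ
    refine ⟨fun v => (p.path v).g (q v), rfl, ⟨max r p.v₁, ?_⟩,
      matAct (T : Matrix (Fin 2) (Fin 2) (ConvLaurent ℝ)) f, ?_, p.onRay_matAct h⟩
    · refine ContinuousOn.eval (p.continuousOn_g.mono fun v hv => ?_) (hr.mono fun v hv => ?_)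
      · exact (le_max_right r p.v₁).trans (le_of_lt hv)
      · exact (le_max_left r p.v₁).trans_lt hv
    · intro h0
      obtain ⟨v, hv⟩ := (p.onRay_matAct h).exists
      exact hv.ne_zero (by rw [h0, ev_zero])⟩
  invFun φ := ⟨Germ.map₂ (fun x t => x.gEquiv.symm t) (p.path : Germ atTop GLTilde) φ.1, by
    obtain ⟨_, q, rfl, ⟨r, hr⟩, f, hf, h⟩ := φ
    set f' := matAct ((T⁻¹ : GL (Fin 2) (ConvLaurent ℝ)) : Matrix (Fin 2) (Fin 2) _) f with hf'
    have hTf : matAct (T : Matrix (Fin 2) (Fin 2) (ConvLaurent ℝ)) f' = f := by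
      rw [hf', ← matAct_mul, ← Units.val_mul, mul_inv_cancel, Units.val_one, matAct_one]
    refine ⟨fun v => (p.path v).gEquiv.symm (q v), rfl, ⟨max r p.v₁, ?_⟩, f', ?_, ?_⟩
    · intro v₀ hv₀
      have hv₁ : p.v₁ < v₀ := (le_max_right r p.v₁).trans_lt hv₀
      have hvr : r < v₀ := (le_max_left r p.v₁).trans_lt hv₀
      refine ContinuousAt.continuousWithinAt ?_
      have hG : ContinuousAt (fun v => (p.path v).g) v₀ :=
        p.continuousOn_g.continuousAt (Ici_mem_nhds hv₁)
      have hq : ContinuousAt q v₀ := hr.continuousAt (Ioi_mem_nhds hvr)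
      set y := (p.path v₀).gEquiv.symm (q v₀) with hy
      have hgy : (p.path v₀).g y = q v₀ := (p.path v₀).gEquiv.apply_symm_apply (q v₀)
      have hGt : ∀ t : ℝ, ContinuousAt (fun v => (p.path v).g t) v₀ := fun t =>
        hG.eval continuousAt_const
      refine tendsto_order.2 ⟨fun t ht => ?_, fun t ht => ?_⟩
      · have h1 : (p.path v₀).g t < q v₀ := hgy ▸ (p.path v₀).strictMono ht
        filter_upwards [(hGt t).eventually_lt hq h1] with v hv
        rw [← (p.path v).strictMono.lt_iff_lt]
        exact hv.trans_eq ((p.path v).gEquiv.apply_symm_apply (q v)).symm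
      · have h1 : q v₀ < (p.path v₀).g t := hgy ▸ (p.path v₀).strictMono ht
        filter_upwards [hq.eventually_lt (hGt t) h1] with v hv
        rw [← (p.path v).strictMono.lt_iff_lt]
        exact ((p.path v).gEquiv.apply_symm_apply (q v)).trans_lt hv
    · intro h0
      exact hf (by rw [← hTf, h0, map_zero])
    · filter_upwards [h, ev_matAct (T : Matrix (Fin 2) (Fin 2) (ConvLaurent ℝ)) f',
        eventually_ge_atTop p.v₁] with v h1 h2 h3
      rw [hTf, ← p.lift v h3] at h2
      have hne : ev f' v ≠ 0 := by
        intro h0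
        apply h1.ne_zero
        rw [h2, h0]
        apply Complex.ext <;> simp [matC]
      have h4 := onRay_arg hne
      have h5 := (p.path v).onRay h4
      rw [← h2] at h5
      obtain ⟨k, hk⟩ := h5.exists_int h1
      have h6 : (p.path v).gEquiv.symm (q v) = Complex.arg (ev f' v) / Real.pi + 2 * k := by
        rw [Equiv.symm_apply_eq, hk]
        have := (p.path v).map_add_int (Complex.arg (ev f' v) / Real.pi) (2 * k)
        push_cast at this
        exact this.symm
      rw [h6]
      exact h4.add_even k⟩
  left_inv φ := by
    obtain ⟨_, q, rfl, h⟩ := φ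
    refine Subtype.ext (congrArg (Germ.ofFun (l := atTop)) (funext fun v => ?_))
    exact (p.path v).gEquiv.symm_apply_apply (q v)
  right_inv φ := by
    obtain ⟨_, q, rfl, h⟩ := φ
    refine Subtype.ext (congrArg (Germ.ofFun (l := atTop)) (funext fun v => ?_))
    exact (p.path v).gEquiv.apply_symm_apply (q v)

end LiftedPath

/-! ### The Grothendieck group of a triangulated category -/

universe v u v' u'

section Grothendieck

variable (C : Type u) [Category.{v} C] [Preadditive C] [HasZeroObject C] [HasShift C ℤ]
  [∀ n : ℤ, (shiftFunctor C n).Additive] [Pretriangulated C]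

/-- The relations `[Y] = [X] + [Z]`, one for each distinguished triangle `X → Y → Z → X[1]`. -/
def K0.relations : AddSubgroup (FreeAbelianGroup C) :=
  AddSubgroup.closure {x | ∃ T ∈ distTriang C, x = FreeAbelianGroup.of T.obj₂ -
    FreeAbelianGroup.of T.obj₁ - FreeAbelianGroup.of T.obj₃}

/-- The Grothendieck group `K(C)`. -/
abbrev K0 : Type u := FreeAbelianGroup C ⧸ K0.relations C

variable {C}

/-- The class `[E]` of an object. -/
def K0.mk (E : C) : K0 C := QuotientAddGroup.mk (FreeAbelianGroup.of E)

theorem K0.mk_triangle {T : Triangle C} (hT : T ∈ distTriang C) :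
    K0.mk T.obj₂ = K0.mk T.obj₁ + K0.mk T.obj₃ := by
  have h : FreeAbelianGroup.of T.obj₂ - FreeAbelianGroup.of T.obj₁ - FreeAbelianGroup.of T.obj₃ ∈
      K0.relations C := AddSubgroup.subset_closure ⟨T, hT, rfl⟩
  have h2 := (QuotientAddGroup.eq_zero_iff _).2 h
  rw [QuotientAddGroup.mk_sub, QuotientAddGroup.mk_sub, sub_sub, sub_eq_zero] at h2
  exact h2

/-- A function on objects that is additive on distinguished triangles descends to `K(C)`. -/
def K0.lift {G : Type*} [AddCommGroup G] (F : C → G)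
    (hF : ∀ T ∈ distTriang C, F T.obj₂ = F T.obj₁ + F T.obj₃) : K0 C →+ G :=
  QuotientAddGroup.lift (K0.relations C) (FreeAbelianGroup.lift F) (by
    rw [K0.relations, AddSubgroup.closure_le]
    rintro _ ⟨T, hT, rfl⟩
    simp [hF T hT])

@[simp]
theorem K0.lift_mk {G : Type*} [AddCommGroup G] (F : C → G)
    (hF : ∀ T ∈ distTriang C, F T.obj₂ = F T.obj₁ + F T.obj₃) (E : C) :
    K0.lift F hF (K0.mk E) = F E := by
  simp [K0.lift, K0.mk]

theorem K0.hom_ext {G : Type*} [AddCommGroup G] {f g : K0 C →+ G}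
    (h : ∀ E : C, f (K0.mk E) = g (K0.mk E)) : f = g := by
  apply QuotientAddGroup.addMonoidHom_ext
  apply FreeAbelianGroup.lift_ext
  exact h

theorem K0.mk_eq_of_iso {X Y : C} (e : X ≅ Y) : K0.mk X = K0.mk Y := by
  have h0 : K0.mk (0 : C) = 0 := by
    simpa using K0.mk_triangle (contractible_distinguished (0 : C))
  have h : Triangle.mk e.hom (0 : Y ⟶ 0) 0 ∈ distTriang C := by
    refine isomorphic_distinguished _ (contractible_distinguished X) _ ?_
    exact Triangle.isoMk _ _ (Iso.refl _) e.symm (Iso.refl _)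
      (by change e.hom ≫ e.inv = 𝟙 X ≫ 𝟙 X; simp)
      (by change (0 : Y ⟶ 0) ≫ 𝟙 0 = e.inv ≫ (0 : X ⟶ 0); simp)
      ((isZero_zero C).eq_of_src _ _)
  have := K0.mk_triangle h
  simp only [Triangle.mk_obj₁, Triangle.mk_obj₂, Triangle.mk_obj₃, h0, add_zero] at this
  exact this.symm

variable {D : Type u'} [Category.{v'} D] [Preadditive D] [HasZeroObject D] [HasShift D ℤ]
  [∀ n : ℤ, (shiftFunctor D n).Additive] [Pretriangulated D]

/-- The homomorphism `Φᴷ : K(C) → K(D)`, `[E] ↦ [Φ E]`, induced by an exact functor. -/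
def K0.map (Φ : C ⥤ D) [Φ.CommShift ℤ] [Φ.IsTriangulated] : K0 C →+ K0 D :=
  K0.lift (fun E => K0.mk (Φ.obj E)) fun T hT => K0.mk_triangle (Φ.map_distinguished T hT)

@[simp]
theorem K0.map_mk (Φ : C ⥤ D) [Φ.CommShift ℤ] [Φ.IsTriangulated] (E : C) :
    K0.map Φ (K0.mk E) = K0.mk (Φ.obj E) :=
  K0.lift_mk _ _ E

theorem K0.map_bijective (Φ : C ⥤ D) [Φ.CommShift ℤ] [Φ.IsTriangulated] [Φ.IsEquivalence] :
    Function.Bijective (K0.map Φ) := by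
  have key : ∀ {X : C} {Y : D}, (Φ.obj X ≅ Y) → K0.mk (Φ.objPreimage Y) = K0.mk X :=
    fun f => K0.mk_eq_of_iso (Φ.preimageIso (Φ.objObjPreimageIso _ ≪≫ f.symm))
  let g : K0 D →+ K0 C := K0.lift (fun E => K0.mk (Φ.objPreimage E)) fun T hT => by
    obtain ⟨T', hT', ⟨e⟩⟩ := Φ.mem_mapTriangle_essImage_of_distinguished T hT
    have h1 : K0.mk (Φ.objPreimage T.obj₁) = K0.mk T'.obj₁ := key (Triangle.π₁.mapIso e)
    have h2 : K0.mk (Φ.objPreimage T.obj₂) = K0.mk T'.obj₂ := key (Triangle.π₂.mapIso e)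
    have h3 : K0.mk (Φ.objPreimage T.obj₃) = K0.mk T'.obj₃ := key (Triangle.π₃.mapIso e)
    rw [h1, h2, h3, K0.mk_triangle hT']
  have hg : ∀ E : D, g (K0.mk E) = K0.mk (Φ.objPreimage E) := fun E => K0.lift_mk _ _ E
  have h1 : g.comp (K0.map Φ) = AddMonoidHom.id _ := K0.hom_ext fun E => by
    rw [AddMonoidHom.comp_apply, K0.map_mk, hg, key (Iso.refl _), AddMonoidHom.id_apply]
  have h2 : (K0.map Φ).comp g = AddMonoidHom.id _ := K0.hom_ext fun E => by
    rw [AddMonoidHom.comp_apply, hg, K0.map_mk, K0.mk_eq_of_iso (Φ.objObjPreimageIso E),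
      AddMonoidHom.id_apply]
  exact ⟨Function.LeftInverse.injective (DFunLike.congr_fun h1),
    Function.RightInverse.surjective (DFunLike.congr_fun h2)⟩

/-- The isomorphism `Φᴷ : K(C) → K(D)` induced by an exact equivalence. -/
def K0.mapEquiv (Φ : C ⥤ D) [Φ.CommShift ℤ] [Φ.IsTriangulated] [Φ.IsEquivalence] :
    K0 C ≃+ K0 D :=
  AddEquiv.ofBijective (K0.map Φ) (K0.map_bijective Φ)

end Grothendieck

/-! ### Polynomial stability on the heart of a t-structure -/

/-- A torsion pair `(T, F)` in an abelian category. -/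
def IsTorsionPair {A : Type*} [Category* A] [Preadditive A] (T F : ObjectProperty A) : Prop :=
  (∀ ⦃X Y : A⦄, T X → F Y → ∀ f : X ⟶ Y, f = 0) ∧
  ∀ E : A, ∃ (X Y : A) (f : X ⟶ E) (g : E ⟶ Y) (w : f ≫ g = 0),
    T X ∧ F Y ∧ (ShortComplex.mk f g w).ShortExact

section Stability

variable {C : Type u} [Category.{v} C] [Preadditive C] [HasZeroObject C] [HasShift C ℤ]
  [∀ n : ℤ, (shiftFunctor C n).Additive] [Pretriangulated C] (t : TStructure C)

/-- The heart of `t`, as a full subcategory of `C`. -/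
abbrev HeartCat : Type u := t.heart.FullSubcategory

/-- The t-structure is bounded. -/
def IsBoundedTStructure : Prop := ∀ X : C, t.bounded X

section Weight

variable {R : Type} [AddCommGroup R] [LinearOrder R] [IsOrderedAddMonoid R]

/-- Semistability in the heart with respect to a weight function `S : K(C) → R`, where `R` is a
totally ordered abelian group. -/
def IsWeightSemistable (S : K0 C →+ R) (E : HeartCat t) : Prop :=
  ¬ IsZero E ∧ S (K0.mk E.obj) = 0 ∧
    ∀ ⦃E' : HeartCat t⦄ (f : E' ⟶ E), Mono f → ¬ IsZero E' → ¬ IsIso f → S (K0.mk E'.obj) ≤ 0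

/-- Refinement-0 of a weight function with respect to `(T, F)`. -/
def Refinement0 (S : K0 C →+ R) (T F : ObjectProperty (HeartCat t)) : Prop :=
  (∀ E, IsWeightSemistable t S E → T E) ∧ ∀ G, F G → ¬ IsZero G → S (K0.mk G.obj) < 0

/-- Refinement-1 of a weight function with respect to `(T, F)`. -/
def Refinement1 (S : K0 C →+ R) (T F : ObjectProperty (HeartCat t)) : Prop :=
  (∀ E, IsWeightSemistable t S E → F E) ∧ ∀ G, T G → ¬ IsZero G → 0 < S (K0.mk G.obj)

end Weight

/-- `ℍ[r] = ℝ_{>0} e^{iπ(r, r+1]}`. -/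
def halfPlane (r : ℝ) : Set ℂ := {z | ∃ θ ∈ Set.Ioc r (r + 1), OnRay z θ}

variable (Z : K0 C →+ ConvLaurent ℂ) (φ₀ : PhaseFn)

/-- `Z` is a polynomial stability function on the heart with respect to `(φ₀, φ₀ + 1]`: for every
nonzero `E` in the heart, `Z(E)(v) ∈ ℝ_{>0} e^{iπ(φ₀(v), φ₀(v)+1]}` for `v ≫ 0`. -/
def IsPolyStabFun : Prop :=
  ∀ E : C, t.heart E → ¬ IsZero E →
    (φ₀ : RealGerm).LiftRel (fun r z => z ∈ halfPlane r) (evGerm (Z (K0.mk E)))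

/-- The phase function `φ_Z(E)` of a nonzero object `E` of the heart: the germ whose value at `v`
is the number congruent to `arg(Z(E)(v))/π` modulo `2` in the interval `(φ₀(v), φ₀(v) + 2]`. Since
`Z(E)(v) ∈ ℝ_{>0} e^{iπ(φ₀(v), φ₀(v)+1]}`, it is the number `θ ∈ (φ₀(v), φ₀(v) + 1]` such that
`Z(E)(v) ∈ ℝ_{>0} e^{iπθ}`; see `toIocMod_spec`. -/
def phase (E : C) : RealGerm :=
  Germ.map₂ (fun r z => toIocMod (two_pos : (0 : ℝ) < 2) r (Complex.arg z / Real.pi))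
    (φ₀ : RealGerm) (evGerm (Z (K0.mk E)))

theorem toIocMod_spec {r : ℝ} {z : ℂ} (hz : z ∈ halfPlane r) :
    toIocMod (two_pos : (0 : ℝ) < 2) r (Complex.arg z / Real.pi) ∈ Set.Ioc r (r + 1) ∧
      OnRay z (toIocMod (two_pos : (0 : ℝ) < 2) r (Complex.arg z / Real.pi)) := by
  obtain ⟨θ, hθ, h⟩ := hz
  obtain ⟨k, hk⟩ := h.exists_int (onRay_arg h.ne_zero)
  have : toIocMod (two_pos : (0 : ℝ) < 2) r (Complex.arg z / Real.pi) = θ := by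
    rw [toIocMod_eq_iff]
    refine ⟨⟨hθ.1, by linarith [hθ.2]⟩, k, ?_⟩
    rw [hk, zsmul_eq_mul]; ring
  rw [this]
  exact ⟨hθ, h⟩

/-- A nonzero object `E` of the heart is `Z`-semistable if `φ_Z(M) ≼ φ_Z(N)` for every short exact
sequence `0 → M → E → N → 0` in the heart with `M, N ≠ 0`. -/
def IsSemistableInHeart (E : HeartCat t) : Prop :=
  ¬ IsZero E ∧ ∀ ⦃M N : HeartCat t⦄ (f : M ⟶ E) (g : E ⟶ N) (w : f ≫ g = 0),
    (ShortComplex.mk f g w).ShortExact → ¬ IsZero M → ¬ IsZero N →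
      phase Z φ₀ M.obj ≤ phase Z φ₀ N.obj

/-- The same with the strict inequality `φ_Z(M) ≺ φ_Z(N)`. -/
def IsStableInHeart (E : HeartCat t) : Prop :=
  ¬ IsZero E ∧ ∀ ⦃M N : HeartCat t⦄ (f : M ⟶ E) (g : E ⟶ N) (w : f ≫ g = 0),
    (ShortComplex.mk f g w).ShortExact → ¬ IsZero M → ¬ IsZero N →
      phase Z φ₀ M.obj ≺ phase Z φ₀ N.obj

/-- An object `E` of `C` is `Z`-semistable if some shift `E[j]` is a `Z`-semistable object of the
heart. -/
def IsSemistable (E : C) : Prop :=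
  ∃ (j : ℤ) (h : t.heart (E⟦j⟧)), IsSemistableInHeart t Z φ₀ ⟨E⟦j⟧, h⟩

/-- An object `E` of `C` is `Z`-stable if some shift `E[j]` is a `Z`-stable object of the heart. -/
def IsStable (E : C) : Prop :=
  ∃ (j : ℤ) (h : t.heart (E⟦j⟧)), IsStableInHeart t Z φ₀ ⟨E⟦j⟧, h⟩

/-- The Harder–Narasimhan property: every nonzero object `E` of the heart has a filtration
`0 = E₀ ⊂ E₁ ⊂ ⋯ ⊂ Eₘ = E` in the heart whose quotients `Q k = Eₖ₊₁ / Eₖ` are `Z`-semistable with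
strictly decreasing phases. (The values of `X`, `i`, `Q`, `q` past `m` are irrelevant.) -/
def HasHN : Prop :=
  ∀ E : HeartCat t, ¬ IsZero E →
    ∃ (m : ℕ) (X Q : ℕ → HeartCat t) (i : ∀ k, X k ⟶ X (k + 1)) (q : ∀ k, X (k + 1) ⟶ Q k)
      (w : ∀ k, i k ≫ q k = 0),
      1 ≤ m ∧ IsZero (X 0) ∧ Nonempty (X m ≅ E) ∧
      (∀ k < m, (ShortComplex.mk (i k) (q k) (w k)).ShortExact ∧
        IsSemistableInHeart t Z φ₀ (Q k)) ∧
      ∀ k, k + 1 < m → phase Z φ₀ (Q (k + 1)).obj ≺ phase Z φ₀ (Q k).obj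

/-- The subcategory `P(φ)` of `C`: the `Z`-semistable objects `E` with phase function `φ`, together
with the zero objects. Here the phase of `E` is `φ_Z(E[j]) - j` if `E[j]` is in the heart. -/
def slicing (φ : PhaseFn) : ObjectProperty C := fun E =>
  IsZero E ∨ ∃ (j : ℤ) (h : t.heart (E⟦j⟧)), IsSemistableInHeart t Z φ₀ ⟨E⟦j⟧, h⟩ ∧
    phase Z φ₀ (E⟦j⟧) = (φ : RealGerm) + ((j : ℝ) : RealGerm)

variable (C) in
/-- Pairs `(Z, P)` consisting of a central charge `Z : K(C) → ℂ((1/v))ᶜ` and a family of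
subcategories `P(φ)` indexed by the polynomial phase functions `φ`. -/
@[ext]
structure StabPair where
  Z : K0 C →+ ConvLaurent ℂ
  P : PhaseFn → ObjectProperty C

/-- The pair `(Z, P)` given by `Z` and its slicing. -/
def stabPair : StabPair C := ⟨Z, slicing t Z φ₀⟩

/-- The pair `(Z, P)` is a polynomial stability condition: `Z` is, for some bounded t-structure and
some `φ₀`, a polynomial stability function with the HN property on the heart with respect to
`(φ₀, φ₀ + 1]`, and `P` is its slicing. -/
def StabPair.IsPolyStabCond (σ : StabPair C) : Prop :=
  ∃ (t : TStructure C) (φ₀ : PhaseFn), IsBoundedTStructure t ∧ IsPolyStabFun t σ.Z φ₀ ∧ HasHN t σ.Z φ₀ ∧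
    σ = stabPair t σ.Z φ₀

/-- The action of lifted paths: `(Z, P) · (T, g) = (T⁻¹ Z, φ ↦ P(Γ_T φ))`. -/
def StabPair.actPath (σ : StabPair C) {T : GL (Fin 2) (ConvLaurent ℝ)} (p : LiftedPath T) :
    StabPair C where
  Z := (matAct ((T⁻¹ : GL (Fin 2) (ConvLaurent ℝ)) : Matrix (Fin 2) (Fin 2) (ConvLaurent ℝ))).comp
    σ.Z
  P φ := σ.P (p.Γ φ)

/-- The weight function `S_{Z,M}(E) = -(Im Z(M)) (Re Z(E)) + (Re Z(M)) (Im Z(E))`. -/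
def weight (M : C) : K0 C →+ ConvLaurent ℝ :=
  (AddMonoidHom.mulLeft (-(imL (Z (K0.mk M))))).comp (reL.comp Z) +
    (AddMonoidHom.mulLeft (reL (Z (K0.mk M)))).comp (imL.comp Z)

variable {D : Type u'} [Category.{v'} D] [Preadditive D] [HasZeroObject D] [HasShift D ℤ]
  [∀ n : ℤ, (shiftFunctor D n).Additive] [Pretriangulated D]

/-- The action of an exact equivalence: `Φ · (Z, P) = (Z ∘ (Φᴷ)⁻¹, φ ↦ Φ(P(φ)))`. -/
def StabPair.actEquiv (σ : StabPair C) (Φ : C ⥤ D) [Φ.CommShift ℤ] [Φ.IsTriangulated]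
    [Φ.IsEquivalence] : StabPair D where
  Z := σ.Z.comp (K0.mapEquiv Φ).symm.toAddMonoidHom
  P φ := (σ.P φ).map Φ

/-- `E` is `Φ_B`-WIT`ᵢ`: `Φ E` is isomorphic to an object of `B[-i]`, i.e. `(Φ E)[i]` lies in the
heart `B` of `t`. -/
def IsWIT (t : TStructure D) (Φ : C ⥤ D) (i : ℤ) (E : C) : Prop := t.heart ((Φ.obj E)⟦i⟧)

/-- The full subcategory `W_{i,Φ,A,B}` of the heart `A` of `t` consisting of the `Φ_B`-WIT`ᵢ`
objects, where `B` is the heart of `t'`. -/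
def W (t : TStructure C) (t' : TStructure D) (Φ : C ⥤ D) (i : ℤ) : ObjectProperty (HeartCat t) :=
  fun E => IsWIT t' Φ i E.obj

end Stability

end PolyStab

end

open PolyStab

noncomputable section

namespace PolyStab

-- Everything is moved to `D` and to a single central charge. Pull `B` back along `Φ` to a heart
-- `A'` of `D`, and replace `Z_B` by `T⁻¹ Z_B`, which becomes `Z_A` on `D`. Each `g_v` is increasing
-- and commutes with `x ↦ x + 1`, so the new charge is a stability function on the same heart with
-- respect to `(c, c + 1]`, `c = Γ_T⁻¹(b)`, with the same (semi)stable objects. Thus `A` and `A'`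
-- are two hearts for the same charge, with `a ≺ c ≺ a + 1` and `A ⊂ D^{[0,1]}` for `A'`.
-- Boundedness and orthogonality give `A' ⊂ D^{[-1,0]}` for `A`, so the two hearts play symmetric
-- roles.
--
-- An object of `A ∩ A'` has the same phase in both intervals, hence a phase above `c`; if `F ∈ A`
-- and `F[1] ∈ A'`, then the phase of `F` plus one is at most `c + 1`. Truncation for `A'` writes
-- each object of `A` as an extension of an object of the second kind by one of the first kind. This
-- is the torsion pair, and a semistable object cannot have both parts nonzero. The weight function
-- compares phases with that of `M`; the factor `e^{iπ(-a)}` has modulus one and does not change it.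
-- Phases on the two sides of `c` then give the refinement property.
--
-- For the correspondence of semistable objects, comparing phases inside a heart amounts to the sign
-- of the alternating form `ω(x, y) = Re Z(x) Im Z(y) - Im Z(x) Re Z(y)` on the Grothendieck group.
-- Let `E` be semistable in `A` and `M → E → N` exact in a shift of `A'`. Truncating `N` or `M` for
-- `A`, the octahedral axiom produces an exact sequence in a shift of `A` with middle term `E`, and
-- `ω(M, N)` is the sum of a term whose sign is fixed by the separation at `c` and a term controlled
-- by the semistability of `E` (`SemistableFor.tilt_left`, `SemistableFor.tilt_right`). The same
-- computation serves stability. In the slicings, a change of heart moves the shift and the phase by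
-- the same integer (`slicing_tilt_iff`).

universe w₁ w₂ w₃ w₄

/-! ### Bounded t-structures whose hearts are tilts of one another -/

section TStructures

variable {C : Type w₂} [Category.{w₁} C] [Preadditive C] [HasZeroObject C] [HasShift C ℤ]
  [∀ n : ℤ, (shiftFunctor C n).Additive] [Pretriangulated C]

/-- The object `X` lies in the shifted heart `A[-n]`. -/
def InDeg (t : TStructure C) (n : ℤ) (X : C) : Prop := t.IsLE X n ∧ t.IsGE X n

theorem heart_iff_inDeg (t : TStructure C) (X : C) : t.heart X ↔ InDeg t 0 X :=
  t.mem_heart_iff X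

theorem InDeg.of_iso {t : TStructure C} {n : ℤ} {X Y : C} (h : InDeg t n X) (e : X ≅ Y) :
    InDeg t n Y := by
  have := h.1; have := h.2
  exact ⟨t.isLE_of_iso e n, t.isGE_of_iso e n⟩

theorem inDeg_shift_iff (t : TStructure C) (X : C) (n a n' : ℤ) (h : a + n' = n) :
    InDeg t n' (X⟦a⟧) ↔ InDeg t n X :=
  and_congr (t.isLE_shift_iff X n a n' h) (t.isGE_shift_iff X n a n' h)

theorem heart_shift_iff (t : TStructure C) (X : C) (n : ℤ) :
    t.heart (X⟦n⟧) ↔ InDeg t n X :=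
  (heart_iff_inDeg t _).trans (inDeg_shift_iff t X n n 0 (add_zero n))

theorem inDeg_of_isZero (t : TStructure C) {X : C} (h : IsZero X) (n : ℤ) : InDeg t n X :=
  ⟨t.isLE_of_isZero h n, t.isGE_of_isZero h n⟩

omit [HasZeroObject C] [Pretriangulated C] in
theorem isZero_shift_iff (X : C) (n : ℤ) : IsZero (X⟦n⟧) ↔ IsZero X := by
  constructor
  · intro h
    exact ((shiftFunctor C (-n)).map_isZero h).of_iso ((shiftEquiv C n).unitIso.app X)
  · exact (shiftFunctor C n).map_isZero

theorem InDeg.eq_of_not_isZero {t : TStructure C} {m n : ℤ} {X : C} (hm : InDeg t m X)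
    (hn : InDeg t n X) (h : ¬ IsZero X) : m = n := by
  have := hm.1; have := hm.2; have := hn.1; have := hn.2
  rcases lt_trichotomy m n with hlt | heq | hgt
  · exact (h (t.isZero X m n hlt)).elim
  · exact heq
  · exact (h (t.isZero X n m hgt)).elim

/-- In the inversely rotated triangle `L` is an extension of `X` by `J[-1]`, which explains the loss
of one degree for `J`. -/
theorem isGE_first {t : TStructure C} {L X J : C} {f : L ⟶ X} {g : X ⟶ J} {δ : J ⟶ L⟦(1 : ℤ)⟧}
    (hT : Triangle.mk f g δ ∈ distTriang C) {n : ℤ} (hX : t.IsGE X n) (hJ : t.IsGE J (n - 1)) :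
    t.IsGE L n := by
  refine t.isGE₂ _ (inv_rot_of_distTriang _ hT) n ?_ hX
  exact t.isGE_shift J (n - 1) (-1) n (by lia)

theorem isLE_third {t : TStructure C} {L X J : C} {f : L ⟶ X} {g : X ⟶ J} {δ : J ⟶ L⟦(1 : ℤ)⟧}
    (hT : Triangle.mk f g δ ∈ distTriang C) {n : ℤ} (hX : t.IsLE X n) (hL : t.IsLE L (n + 1)) :
    t.IsLE J n := by
  refine t.isLE₂ _ (rot_of_distTriang _ hT) n hX ?_
  exact t.isLE_shift L (n + 1) 1 n (by lia)

theorem exists_truncation (t : TStructure C) (X : C) (n : ℤ) :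
    ∃ (L J : C) (f : L ⟶ X) (g : X ⟶ J) (δ : J ⟶ L⟦(1 : ℤ)⟧),
      t.IsLE L n ∧ t.IsGE J (n + 1) ∧ Triangle.mk f g δ ∈ distTriang C := by
  obtain ⟨L, J, hL, hJ, f, g, δ, h⟩ := t.exists_triangle X n (n + 1) rfl
  exact ⟨L, J, f, g, δ, ⟨hL⟩, ⟨hJ⟩, h⟩

variable {t t' : TStructure C} {p : ℤ}

/-- By boundedness an object is a finite iterated extension of its cohomology objects, and `t'.IsGE`
is stable under extensions. The induction removes the lowest cohomology object; in the dual
statement below, the highest one. -/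
theorem IsBoundedTStructure.isGE_of_inDeg (ht : IsBoundedTStructure t)
    (h : ∀ m X, InDeg t m X → t'.IsGE X (m + p)) (n : ℤ) (X : C) (hX : t.IsGE X n) :
    t'.IsGE X (n + p) := by
  -- `k` counts the degrees `n, …, n + k - 1` where cohomology may occur; for `k = 0` the two bounds
  -- contradict each other and `X = 0`.
  have key : ∀ (k : ℕ) (n : ℤ) (X : C), t.IsGE X n → t.IsLE X (n + k - 1) →
      t'.IsGE X (n + p) := by
    intro k
    induction k with
    | zero =>
      intro n X h1 h2
      exact t'.isGE_of_isZero (t.isZero X (n + (0 : ℕ) - 1) n (by push_cast; lia)) _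
    | succ k ih =>
      intro n X h1 h2
      obtain ⟨L, J, f, g, δ, hL, hJ, hT⟩ := exists_truncation t X n
      have hL' : t.IsGE L n := isGE_first hT h1 (t.isGE_of_ge J (n - 1) (n + 1))
      have hJ' : t.IsLE J (n + (k + 1 : ℕ) - 1) :=
        isLE_third hT h2 (t.isLE_of_le L n _ (by push_cast; lia))
      have e : n + ((k + 1 : ℕ) : ℤ) - 1 = n + 1 + k - 1 := by push_cast; lia
      rw [e] at hJ'
      have hJ'' := ih (n + 1) J hJ hJ'
      exact t'.isGE₂ _ hT (n + p) (h n L ⟨hL, hL'⟩) (t'.isGE_of_ge J (n + p) (n + 1 + p))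
  obtain ⟨N, hN⟩ := (ht X).2
  refine key (N - n + 1).toNat n X hX (t.isLE_of_le X N _ ?_)
  have := Int.self_le_toNat (N - n + 1)
  lia

theorem IsBoundedTStructure.isLE_of_inDeg (ht : IsBoundedTStructure t)
    (h : ∀ m X, InDeg t m X → t'.IsLE X (m + p)) (n : ℤ) (X : C) (hX : t.IsLE X n) :
    t'.IsLE X (n + p) := by
  have key : ∀ (k : ℕ) (n : ℤ) (X : C), t.IsLE X n → t.IsGE X (n - k + 1) →
      t'.IsLE X (n + p) := by
    intro k
    induction k with
    | zero =>
      intro n X h1 h2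
      exact t'.isLE_of_isZero (t.isZero X n (n - (0 : ℕ) + 1) (by push_cast; lia)) _
    | succ k ih =>
      intro n X h1 h2
      obtain ⟨L, J, f, g, δ, hL, hJ, hT⟩ := exists_truncation t X (n - 1)
      rw [sub_add_cancel] at hJ
      have hJ' : t.IsLE J n := isLE_third hT h1 (t.isLE_of_le L (n - 1) (n + 1))
      have hL' : t.IsGE L (n - (k + 1 : ℕ) + 1) :=
        isGE_first hT h2 (t.isGE_of_ge J _ n (by push_cast; lia))
      have e : n - ((k + 1 : ℕ) : ℤ) + 1 = n - 1 - k + 1 := by push_cast; lia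
      rw [e] at hL'
      have hL'' := ih (n - 1) L hL hL'
      exact t'.isLE₂ _ hT (n + p) (t'.isLE_of_le L (n - 1 + p) (n + p)) (h n J ⟨hJ', hJ⟩)
  obtain ⟨N, hN⟩ := (ht X).1
  refine key (n - N + 1).toNat n X hX (t.isGE_of_ge X _ N ?_)
  have := Int.self_le_toNat (n - N + 1)
  lia

/-- The heart `A` of `t` is contained in `D^{[p, p+1]}` for `t'`. -/
def IsTilt (t t' : TStructure C) (p : ℤ) : Prop :=
  ∀ m X, InDeg t m X → t'.IsGE X (m + p) ∧ t'.IsLE X (m + p + 1)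

theorem isTilt_of_heart
    (h : ∀ X, t.heart X → t'.IsGE X p ∧ t'.IsLE X (p + 1)) : IsTilt t t' p := by
  intro m X hX
  have h' := h _ ((heart_shift_iff t X m).2 hX)
  exact ⟨(t'.isGE_shift_iff X (m + p) m p).1 h'.1, (t'.isLE_shift_iff X (m + p + 1) m (p + 1)).1 h'.2⟩

/-- Both bounds are orthogonality statements: an object low enough for `t` is still low enough for
`t'` to have no map to `X`, and dually. The map `p ↦ -p - 1` is an involution, so what is proved for
`(t, t', p)` also applies to `(t', t, -p - 1)`. -/
theorem IsTilt.symm (h : IsTilt t t' p) (ht : IsBoundedTStructure t) :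
    IsTilt t' t (-p - 1) := by
  intro m X ⟨h1, h2⟩
  constructor
  · refine (t.isGE_iff_orthogonal (m - p - 2) _ (by lia) X).2 fun Y f hY => ?_
    have := ht.isLE_of_inDeg (t' := t') (p := p + 1)
      (fun m X hX => by rw [← add_assoc]; exact (h m X hX).2) _ Y hY
    exact t'.zero f (m - p - 2 + (p + 1)) m
  · refine (t.isLE_iff_orthogonal _ (m - p + 1) (by lia) X).2 fun Y f hY => ?_
    have := ht.isGE_of_inDeg (t' := t') (fun m X hX => (h m X hX).1) _ Y hY
    exact t'.zero f m (m - p + 1 + p)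

/-- Truncating an object of a shift of `A` with respect to `t'`. -/
theorem IsTilt.exists_triangle (h : IsTilt t t' p) (h' : IsTilt t' t (-p - 1)) {m : ℤ} {X : C}
    (hX : InDeg t m X) :
    ∃ (L J : C) (f : L ⟶ X) (g : X ⟶ J) (δ : J ⟶ L⟦(1 : ℤ)⟧),
      Triangle.mk f g δ ∈ distTriang C ∧ InDeg t m L ∧ InDeg t' (m + p) L ∧
        InDeg t m J ∧ InDeg t' (m + p + 1) J := by
  obtain ⟨L, J, f, g, δ, hL, hJ, hT⟩ := exists_truncation t' X (m + p)
  have hJ' : InDeg t' (m + p + 1) J :=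
    ⟨isLE_third hT (h m X hX).2 (t'.isLE_of_le L (m + p) _), hJ⟩
  have hL' : InDeg t' (m + p) L :=
    ⟨hL, isGE_first hT (h m X hX).1 (t'.isGE_of_ge J _ (m + p + 1))⟩
  have h1 := h' _ L hL'
  have h2 := h' _ J hJ'
  -- The reverse tilt supplies the upper bound of `L` and the lower bound of `J`; the other two then
  -- follow from the triangle.
  have hLm : t.IsLE L m := by have := h1.2; exact t.isLE_of_le L (m + p + (-p - 1) + 1) m
  have hJm : t.IsGE J m := by have := h2.1; exact t.isGE_of_ge J m (m + p + 1 + (-p - 1))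
  refine ⟨L, J, f, g, δ, hT, ⟨hLm, ?_⟩, hL', ⟨?_, hJm⟩, hJ'⟩
  · exact isGE_first hT hX.2 (t.isGE_of_ge J _ m)
  · exact isLE_third hT hX.1 (t.isLE_of_le L m _)

theorem K0.mk_isZero {X : C} (h : IsZero X) : K0.mk X = 0 := by
  have h0 : K0.mk (0 : C) = 0 := by
    simpa using K0.mk_triangle (contractible_distinguished (0 : C))
  rw [← h0]
  exact K0.mk_eq_of_iso (h.iso (isZero_zero C))

theorem K0.mk_shift_one (X : C) : K0.mk (X⟦(1 : ℤ)⟧) = -K0.mk X := by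
  have h := K0.mk_triangle (rot_of_distTriang _ (contractible_distinguished X))
  simp only [contractibleTriangle, Triangle.rotate_obj₁, Triangle.rotate_obj₂,
    Triangle.rotate_obj₃, Triangle.mk_obj₁, Triangle.mk_obj₂, Triangle.mk_obj₃] at h
  rw [K0.mk_isZero (isZero_zero C)] at h
  exact (neg_eq_of_add_eq_zero_right h.symm).symm

theorem K0.mk_shift (X : C) (n : ℤ) : K0.mk (X⟦n⟧) = (n.negOnePow : ℤ) • K0.mk X := by
  have step : ∀ n : ℤ, K0.mk (X⟦n + 1⟧) = -K0.mk (X⟦n⟧) := fun n => by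
    rw [← K0.mk_shift_one]
    exact K0.mk_eq_of_iso ((shiftFunctorAdd C n 1).app X)
  induction n using Int.induction_on with
  | zero => simpa using K0.mk_eq_of_iso ((shiftFunctorZero C ℤ).app X)
  | succ n ih => rw [step, ih, Int.negOnePow_succ]; simp
  | pred n ih =>
    have h := step (-n - 1)
    rw [sub_add_cancel, ih] at h
    rw [Int.negOnePow_sub, ← neg_eq_iff_eq_neg.2 h]; simp

end TStructures

/-! ### Semistability for an alternating pairing, and its invariance under tilting -/

section Semistability

variable {C : Type w₂} [Category.{w₁} C] [Preadditive C] [HasZeroObject C] [HasShift C ℤ]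
  [∀ n : ℤ, (shiftFunctor C n).Additive] [Pretriangulated C]
  {R : Type} [AddCommGroup R] [LinearOrder R] [IsOrderedAddMonoid R]

/-- Semistability (for `P x = (0 ≤ x)`) or stability (for `P x = (0 < x)`) of an object of the
shifted heart `A[-n]`, with respect to an alternating pairing `ω` on the Grothendieck group. -/
def SemistableFor (t : TStructure C) (ω : K0 C →+ K0 C →+ R) (P : R → Prop) (n : ℤ) (E : C) :
    Prop :=
  InDeg t n E ∧ ¬ IsZero E ∧ ∀ ⦃M N : C⦄ (f : M ⟶ E) (g : E ⟶ N) (δ : N ⟶ M⟦(1 : ℤ)⟧),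
    Triangle.mk f g δ ∈ distTriang C → InDeg t n M → InDeg t n N → ¬ IsZero M → ¬ IsZero N →
      P (ω (K0.mk M) (K0.mk N))

variable {t t' : TStructure C} {ω : K0 C →+ K0 C →+ R} {P : R → Prop} {n p : ℤ}

theorem dist_of_iso₂ {M E E' N : C} {f : M ⟶ E} {g : E ⟶ N} {δ : N ⟶ M⟦(1 : ℤ)⟧}
    (hT : Triangle.mk f g δ ∈ distTriang C) (e : E ≅ E') :
    Triangle.mk (f ≫ e.hom) (e.inv ≫ g) δ ∈ distTriang C :=
  isomorphic_distinguished _ hT _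
    (Triangle.isoMk _ _ (Iso.refl _) e.symm (Iso.refl _)
      (by change (f ≫ e.hom) ≫ e.inv = 𝟙 M ≫ f; simp)
      (by change (e.inv ≫ g) ≫ 𝟙 N = e.inv ≫ g; simp)
      (by change δ ≫ (𝟙 M)⟦(1 : ℤ)⟧' = 𝟙 N ≫ δ; simp))

omit [LinearOrder R] [IsOrderedAddMonoid R] in
theorem SemistableFor.of_iso {E E' : C} (h : SemistableFor t ω P n E) (e : E ≅ E') :
    SemistableFor t ω P n E' := by
  refine ⟨h.1.of_iso e, fun h0 => h.2.1 (h0.of_iso e), fun M N f g δ hT => ?_⟩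
  exact h.2.2 _ _ δ (dist_of_iso₂ hT e.symm)

omit [LinearOrder R] [IsOrderedAddMonoid R] in
-- Shifting back by `a` multiplies both classes by the same sign, so the bilinear pairing does not
-- change.
theorem SemistableFor.shift {E : C} (h : SemistableFor t ω P n E) (a n' : ℤ) (hn : a + n' = n) :
    SemistableFor t ω P n' (E⟦a⟧) := by
  refine ⟨(inDeg_shift_iff t E n a n' hn).2 h.1, fun h0 => h.2.1 ((isZero_shift_iff E a).1 h0),
    fun M N f g δ hT hM hN hM0 hN0 => ?_⟩
  have hT' := dist_of_iso₂ (Triangle.shift_distinguished _ hT (-a))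
    ((shiftEquiv C a).unitIso.symm.app E)
  have := h.2.2 _ _ _ hT' ((inDeg_shift_iff t M n' (-a) n (by lia)).2 hM)
    ((inDeg_shift_iff t N n' (-a) n (by lia)).2 hN) (fun h0 => hM0 ((isZero_shift_iff _ _).1 h0))
    (fun h0 => hN0 ((isZero_shift_iff _ _).1 h0))
  dsimp at this
  rw [K0.mk_shift, K0.mk_shift] at this
  rcases Int.even_or_odd a with ha | ha
  · simpa [Int.negOnePow_even _ ha] using this
  · simpa [Int.negOnePow_odd _ ha] using this

omit [LinearOrder R] [IsOrderedAddMonoid R] in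
theorem semistableFor_shift_iff (E : C) (a n n' : ℤ) (hn : a + n' = n) :
    SemistableFor t ω P n' (E⟦a⟧) ↔ SemistableFor t ω P n E :=
  ⟨fun h => (h.shift (-a) n (by lia)).of_iso ((shiftEquiv C a).unitIso.symm.app E),
    fun h => h.shift a n' hn⟩

/-- The pairing is positive on pairs `(X, L)`, where `X` and `L[-1]` are objects of `A` that are
carried to `A'` and `A'[-1]`. -/
def IsPositive (t t' : TStructure C) (p : ℤ) (ω : K0 C →+ K0 C →+ R) : Prop :=
  ∀ ⦃m : ℤ⦄ ⦃X L : C⦄, InDeg t m X → InDeg t' (m + p) X → InDeg t (m - 1) L →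
    InDeg t' (m + p) L → ¬ IsZero X → ¬ IsZero L → 0 < ω (K0.mk X) (K0.mk L)

omit [LinearOrder R] [IsOrderedAddMonoid R] in
theorem pairing_swap (hω : ∀ x, ω x x = 0) (x y : K0 C) : ω x y = -ω y x := by
  have h := hω (x + y)
  simp only [map_add, AddMonoidHom.add_apply, hω, zero_add, add_zero] at h
  exact eq_neg_of_add_eq_zero_right h

omit [IsOrderedAddMonoid R] in
-- A pair `(X, L)` for `(t', t)` gives the pair `(L, X[1])` for `(t, t')`; the sign of the shift
-- cancels that of exchanging the arguments.
theorem IsPositive.symm (h : IsPositive t t' p ω) (hω : ∀ x, ω x x = 0) :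
    IsPositive t' t (-p - 1) ω := by
  intro m X L h1 h2 h3 h4 hX hL
  have e : m - 1 = m + (-p - 1) + p := by ring
  have := h (m := m + (-p - 1)) (X := L) (L := X⟦(1 : ℤ)⟧) h4 (e ▸ h3)
    ((inDeg_shift_iff t X (m + (-p - 1)) 1 _ (by ring)).2 h2)
    ((inDeg_shift_iff t' X m 1 _ (by ring)).2 h1) hL
    (fun h0 => hX ((isZero_shift_iff _ _).1 h0))
  rwa [K0.mk_shift_one, map_neg, ← pairing_swap hω] at this

/-- Semistable objects are carried to an object of a single shift of the other heart. -/
theorem SemistableFor.inDeg_or (h : IsTilt t t' p) (h' : IsTilt t' t (-p - 1))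
    (hpos : IsPositive t t' p ω) (hP : ∀ x, P x → 0 ≤ x) {E : C} (hE : SemistableFor t ω P n E) :
    InDeg t' (n + p) E ∨ InDeg t' (n + p + 1) E := by
  obtain ⟨L, J, f, g, δ, hT, hL, hL', hJ, hJ'⟩ := h.exists_triangle h' hE.1
  by_cases hL0 : IsZero L
  · right
    have : IsIso g := (Triangle.isZero₁_iff_isIso₂ _ hT).1 hL0
    exact hJ'.of_iso (asIso g).symm
  by_cases hJ0 : IsZero J
  · left
    have : IsIso f := (Triangle.isZero₃_iff_isIso₁ _ hT).1 hJ0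
    exact hL'.of_iso (asIso f)
  exfalso
  -- If both truncations are nonzero, semistability gives `0 ≤ ω(L, J)`, whereas positivity on the
  -- pair `(L, J[1])` gives `ω(L, J) < 0`.
  have h1 := hP _ (hE.2.2 f g δ hT hL hJ hL0 hJ0)
  have h2 := hpos (m := n) (X := L) (L := J⟦(1 : ℤ)⟧) hL hL'
    ((inDeg_shift_iff t J n 1 _ (by ring)).2 hJ) ((inDeg_shift_iff t' J (n + p + 1) 1 _ (by ring)).2 hJ')
    hL0 (fun h0 => hJ0 ((isZero_shift_iff _ _).1 h0))
  rw [K0.mk_shift_one, map_neg] at h2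
  exact absurd h1 (not_le.2 (neg_pos.1 h2))

variable [IsTriangulated C]

/-- Let `M → E → N` be exact in the shift of `A'`, and `L → N → J` the truncation of `N` for `t`,
with `L` in degree `n - 1` and `J` in degree `n`. The fibre `I` of `E → J` is an extension of `L` by
`M`, and `I → E → J` is exact in the shift of `A`. Since `[M] = [I] - [L]`, one finds `ω(M, N) =
ω(E, L) + ω(I, J)`: the first term is positive if `L ≠ 0`, the second is controlled by `E`. The two
conditions on `P` allow both `0 ≤ ·` and `0 < ·`. -/
theorem SemistableFor.tilt_left (h : IsTilt t t' p) (h' : IsTilt t' t (-p - 1))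
    (hpos : IsPositive t t' p ω) (hω : ∀ x, ω x x = 0) (hP : ∀ x, P x → 0 ≤ x)
    (hP' : ∀ x, 0 < x → P x) {E : C} (hE : SemistableFor t ω P n E) (hE' : InDeg t' (n + p) E) :
    SemistableFor t' ω P (n + p) E := by
  refine ⟨hE', hE.2.1, fun M N f g δ hT hM hN hM0 hN0 => ?_⟩
  obtain ⟨L, J, f₂, g₂, δ₂, hT₂, hL', hL, hJ', hJ⟩ :=
    h'.exists_triangle (by rwa [show -(-p - 1) - 1 = p by ring]) hN
  rw [show n + p + (-p - 1) = n - 1 by ring] at hL hJ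
  rw [sub_add_cancel] at hJ
  obtain ⟨I, i, k, hT₃⟩ := distinguished_cocone_triangle₁ (g ≫ g₂)
  have o := someOctahedron' rfl hT hT₂ hT₃
  -- The upper bound comes from the octahedral triangle `M → I → L`, where the reverse tilt bounds
  -- `M`; the lower bound comes from `I → E → J`.
  have hI : InDeg t n I := by
    have := hE.1.1; have := hE.1.2; have := hJ.1; have := hJ.2; have := hL.1
    refine ⟨t.isLE₂ _ o.mem n ?_ (t.isLE_of_le L (n - 1) n), ?_⟩
    · have := (h' _ M hM).2
      exact t.isLE_of_le M (n + p + (-p - 1) + 1) n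
    · exact isGE_first hT₃ ‹_› (t.isGE_of_ge J (n - 1) n)
  have e1 : K0.mk I = K0.mk M + K0.mk L := K0.mk_triangle o.mem
  have e2 : K0.mk E = K0.mk M + K0.mk N := K0.mk_triangle hT
  have e3 : K0.mk E = K0.mk I + K0.mk J := K0.mk_triangle hT₃
  have key : ω (K0.mk M) (K0.mk N) = ω (K0.mk E) (K0.mk L) + ω (K0.mk I) (K0.mk J) := by
    have h1 : ω (K0.mk M) (K0.mk N) = ω (K0.mk M) (K0.mk E) := by
      rw [e2, map_add, hω, zero_add]
    have h2 : ω (K0.mk I) (K0.mk J) = ω (K0.mk I) (K0.mk E) := by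
      rw [e3, map_add, hω, zero_add]
    rw [h1, h2, e1, map_add, AddMonoidHom.add_apply, pairing_swap hω (K0.mk L)]
    abel
  rw [key]
  have hIJ : ¬ IsZero I → ¬ IsZero J → P (ω (K0.mk I) (K0.mk J)) :=
    hE.2.2 i (g ≫ g₂) k hT₃ hI hJ
  -- For `L = 0` there is no strict contribution, but then `M ≅ I` and `N ≅ J`, so the condition on
  -- `E` applies as it stands. For `L ≠ 0` the sum is strictly positive even if `I` or `J` vanishes.
  by_cases hL0 : IsZero L
  · have i1 : IsIso o.m₁ := (Triangle.isZero₃_iff_isIso₁ _ o.mem).1 hL0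
    have i2 : IsIso g₂ := (Triangle.isZero₁_iff_isIso₂ _ hT₂).1 hL0
    rw [K0.mk_isZero hL0, map_zero, zero_add]
    exact hIJ (fun h0 => hM0 (h0.of_iso (asIso o.m₁))) (fun h0 => hN0 (h0.of_iso (asIso g₂)))
  · refine hP' _ (add_pos_of_pos_of_nonneg (hpos hE.1 hE' hL hL' hE.2.1 hL0) ?_)
    by_cases hI0 : IsZero I
    · rw [K0.mk_isZero hI0]; simp
    by_cases hJ0 : IsZero J
    · rw [K0.mk_isZero hJ0]; simp
    exact hP _ (hIJ hI0 hJ0)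

/-- Dual argument: now `M` is truncated, as `K → M → J` with `K` in degree `n` and `J` in degree `n
+ 1` for `t`. The cone `I` of `K → E` is an extension of `N` by `J`, and `ω(M, N) = ω(J, E) + ω(K,
I)`. -/
theorem SemistableFor.tilt_right (h : IsTilt t t' p) (h' : IsTilt t' t (-p - 1))
    (hpos : IsPositive t t' p ω) (hω : ∀ x, ω x x = 0) (hP : ∀ x, P x → 0 ≤ x)
    (hP' : ∀ x, 0 < x → P x) {E : C} (hE : SemistableFor t ω P n E)
    (hE' : InDeg t' (n + p + 1) E) :
    SemistableFor t' ω P (n + p + 1) E := by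
  refine ⟨hE', hE.2.1, fun M N f g δ hT hM hN hM0 hN0 => ?_⟩
  obtain ⟨K, J, f₂, g₂, δ₂, hT₂, hK', hK, hJ', hJ⟩ :=
    h'.exists_triangle (by rwa [show -(-p - 1) - 1 = p by ring]) hM
  rw [show n + p + 1 + (-p - 1) = n by ring] at hK hJ
  obtain ⟨I, i, k, hT₃⟩ := distinguished_cocone_triangle (f₂ ≫ f)
  have o := someOctahedron rfl hT₂ hT hT₃
  have hI : InDeg t n I := by
    have := hE.1.1; have := hE.1.2; have := hK.1; have := hK.2; have := hJ.2
    refine ⟨isLE_third hT₃ ‹_› (t.isLE_of_le K n (n + 1)),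
      t.isGE₂ _ o.mem n (t.isGE_of_ge J n (n + 1)) ?_⟩
    have := (h' _ N hN).1
    exact t.isGE_of_ge N n (n + p + 1 + (-p - 1))
  have e1 : K0.mk I = K0.mk J + K0.mk N := K0.mk_triangle o.mem
  have e2 : K0.mk E = K0.mk M + K0.mk N := K0.mk_triangle hT
  have e3 : K0.mk E = K0.mk K + K0.mk I := K0.mk_triangle hT₃
  have key : ω (K0.mk M) (K0.mk N) = ω (K0.mk J) (K0.mk E) + ω (K0.mk K) (K0.mk I) := by
    have h1 : ω (K0.mk M) (K0.mk N) = ω (K0.mk E) (K0.mk N) := by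
      rw [e2, map_add, AddMonoidHom.add_apply, hω, add_zero]
    have h2 : ω (K0.mk K) (K0.mk I) = ω (K0.mk E) (K0.mk I) := by
      rw [e3, map_add, AddMonoidHom.add_apply, hω, add_zero]
    rw [h1, h2, e1, map_add, pairing_swap hω (K0.mk J)]
    abel
  rw [key]
  have hKI : ¬ IsZero K → ¬ IsZero I → P (ω (K0.mk K) (K0.mk I)) :=
    hE.2.2 (f₂ ≫ f) i k hT₃ hK hI
  by_cases hJ0 : IsZero J
  · have i1 : IsIso o.m₃ := (Triangle.isZero₁_iff_isIso₂ _ o.mem).1 hJ0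
    have i2 : IsIso f₂ := (Triangle.isZero₃_iff_isIso₁ _ hT₂).1 hJ0
    rw [K0.mk_isZero hJ0, map_zero, AddMonoidHom.zero_apply, zero_add]
    exact hKI (fun h0 => hM0 (h0.of_iso (asIso f₂).symm))
      (fun h0 => hN0 (h0.of_iso (asIso o.m₃).symm))
  · refine hP' _ (add_pos_of_pos_of_nonneg ?_ ?_)
    · refine hpos (m := n + 1) hJ ?_ ?_ ?_ hJ0 hE.2.1
      · rwa [show n + 1 + p = n + p + 1 by ring]
      · rw [add_sub_cancel_right]; exact hE.1
      · rwa [show n + 1 + p = n + p + 1 by ring]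
    by_cases hI0 : IsZero I
    · rw [K0.mk_isZero hI0]; simp
    by_cases hK0 : IsZero K
    · rw [K0.mk_isZero hK0]; simp
    exact hP _ (hKI hK0 hI0)

theorem SemistableFor.exists_tilt (h : IsTilt t t' p) (h' : IsTilt t' t (-p - 1))
    (hpos : IsPositive t t' p ω) (hω : ∀ x, ω x x = 0) (hP : ∀ x, P x → 0 ≤ x)
    (hP' : ∀ x, 0 < x → P x) {E : C} (hE : SemistableFor t ω P n E) :
    ∃ m, SemistableFor t' ω P m E := by
  rcases hE.inDeg_or h h' hpos hP with hE' | hE'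
  · exact ⟨_, hE.tilt_left h h' hpos hω hP hP' hE'⟩
  · exact ⟨_, hE.tilt_right h h' hpos hω hP hP' hE'⟩

theorem exists_semistableFor_iff (h : IsTilt t t' p) (ht : IsBoundedTStructure t)
    (hpos : IsPositive t t' p ω) (hω : ∀ x, ω x x = 0) (hP : ∀ x, P x → 0 ≤ x)
    (hP' : ∀ x, 0 < x → P x) (E : C) :
    (∃ n, SemistableFor t ω P n E) ↔ ∃ n, SemistableFor t' ω P n E := by
  have h' := h.symm ht
  refine ⟨fun ⟨n, hE⟩ => hE.exists_tilt h h' hpos hω hP hP',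
    fun ⟨n, hE⟩ => hE.exists_tilt h' (by rwa [show -(-p - 1) - 1 = p by ring])
      (hpos.symm hω) hω hP hP'⟩

end Semistability

/-! ### Exact sequences in the heart as distinguished triangles -/

section Heart

variable {C : Type w₂} [Category.{w₁} C] [Preadditive C] [HasZeroObject C] [HasShift C ℤ]
  [∀ n : ℤ, (shiftFunctor C n).Additive] [Pretriangulated C] (t : TStructure C)

theorem inDeg_zero_obj (X : HeartCat t) : InDeg t 0 X.obj := (heart_iff_inDeg t _).1 X.property

theorem heart_hom_shift_eq_zero ⦃X Y : HeartCat t⦄ ⦃n : ℤ⦄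
    (f : t.heart.ι.obj X ⟶ (t.heart.ι.obj Y)⟦n⟧) (hn : n < 0) : f = 0 := by
  have hX := (inDeg_zero_obj t X).1
  have hY := ((inDeg_shift_iff t Y.obj 0 n (-n) (by lia)).2 (inDeg_zero_obj t Y)).2
  exact t.zero_of_isLE_of_isGE f 0 (-n) (by lia) hX hY

/-- The cone of a morphism of the heart has cohomology only in degrees `-1` and `0`; its truncation
triangle displays the kernel, shifted by one, and the cokernel. -/
theorem heart_admissibleMorphism :
    AbelianSubcategory.admissibleMorphism t.heart.ι = ⊤ := by
  ext X₁ X₂ f₁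
  simp only [MorphismProperty.top_apply, iff_true]
  intro X₃ f₂ f₃ hT
  obtain ⟨L, J, f, g, δ, hL, hJ, hT'⟩ := exists_truncation t X₃ (-1)
  rw [neg_add_cancel] at hJ
  have h1 := inDeg_zero_obj t X₁
  have h2 := inDeg_zero_obj t X₂
  have := h1.1; have := h1.2; have := h2.1; have := h2.2
  have hX₃ : t.IsLE X₃ 0 := isLE_third hT h2.1 (t.isLE_of_le X₁.obj 0 (0 + 1))
  have hX₃' : t.IsGE X₃ (-1) := by
    refine t.isGE₂ _ (rot_of_distTriang _ hT) (-1) (t.isGE_of_ge X₂.obj (-1) 0) ?_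
    exact t.isGE_shift X₁.obj 0 1 (-1)
  have hL' : InDeg t (-1) L := ⟨hL, isGE_first hT' hX₃' (t.isGE_of_ge J (-1 - 1) 0)⟩
  have hJ' : InDeg t 0 J := ⟨isLE_third hT' hX₃ (t.isLE_of_le L (-1) (0 + 1)), hJ⟩
  let K : HeartCat t := ⟨L⟦(-1 : ℤ)⟧, (heart_shift_iff t L (-1)).2 hL'⟩
  let Q : HeartCat t := ⟨J, (heart_iff_inDeg t J).2 hJ'⟩
  let e : L⟦(-1 : ℤ)⟧⟦(1 : ℤ)⟧ ≅ L := (shiftEquiv' C (-1 : ℤ) 1 (by simp)).unitIso.symm.app L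
  refine ⟨K, Q, e.hom ≫ f, g, δ ≫ e.inv⟦(1 : ℤ)⟧', ?_⟩
  refine isomorphic_distinguished _ hT' _ (Triangle.isoMk _ _ e (Iso.refl _) (Iso.refl _) ?_ ?_ ?_)
  · change (e.hom ≫ f) ≫ 𝟙 X₃ = e.hom ≫ f; simp
  · change g ≫ 𝟙 J = 𝟙 X₃ ≫ g; simp
  · change (δ ≫ e.inv⟦(1 : ℤ)⟧') ≫ e.hom⟦(1 : ℤ)⟧' = 𝟙 J ≫ δ
    rw [Category.assoc, ← Functor.map_comp, e.inv_hom_id]; simp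

instance : t.heart.ContainsZero where
  exists_zero := ⟨0, isZero_zero C, (heart_iff_inDeg t _).2 (inDeg_of_isZero t (isZero_zero C) 0)⟩

instance : t.heart.IsClosedUnderBinaryProducts where
  limitsOfShape_le := by
    rintro X ⟨p⟩
    have h1 := (heart_iff_inDeg t _).1 (p.prop_diag_obj (.mk .left))
    have h2 := (heart_iff_inDeg t _).1 (p.prop_diag_obj (.mk .right))
    have hT := binaryProductTriangle_distinguished (p.diag.obj (.mk .left))
      (p.diag.obj (.mk .right))
    refine t.heart.prop_of_iso ?_
      ((heart_iff_inDeg t _).2 ⟨t.isLE₂ _ hT 0 h1.1 h2.1, t.isGE₂ _ hT 0 h1.2 h2.2⟩)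
    exact IsLimit.conePointUniqueUpToIso (prodIsProd _ _)
      ((IsLimit.postcomposeHomEquiv (diagramIsoPair p.diag) _).2 p.isLimit)

instance : t.heart.IsClosedUnderFiniteProducts := .mk'

theorem isZero_obj_iff (X : HeartCat t) : IsZero X.obj ↔ IsZero X := by
  rw [IsZero.iff_id_eq_zero, IsZero.iff_id_eq_zero]
  exact ⟨fun h => ObjectProperty.hom_ext _ h, fun h => congrArg InducedCategory.Hom.hom h⟩

variable [IsTriangulated C]

/-- The heart of a t-structure is an abelian category. -/
@[reducible]
def heartAbelian : Abelian (HeartCat t) :=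
  AbelianSubcategory.abelian t.heart.ι (heart_hom_shift_eq_zero t) (heart_admissibleMorphism t)

theorem shortExact_of_dist {M E N : HeartCat t} {f : M ⟶ E} {g : E ⟶ N} (w : f ≫ g = 0)
    {δ : N.obj ⟶ M.obj⟦(1 : ℤ)⟧} (hT : Triangle.mk f.hom g.hom δ ∈ distTriang C) :
    (ShortComplex.mk f g w).ShortExact := by
  let _ := heartAbelian t
  have hk := AbelianSubcategory.isLimitKernelForkOfDistTriang (heart_hom_shift_eq_zero t) f g δ hT
  have hc := AbelianSubcategory.isColimitCokernelCoforkOfDistTriang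
    (heart_hom_shift_eq_zero t) f g δ hT
  exact ShortComplex.ShortExact.mk' (ShortComplex.exact_of_f_is_kernel _ hk)
    (mono_of_isLimit_fork hk) (epi_of_isColimit_cofork hc)

/-- The epimorphism `g` completes to a triangle with all vertices in the heart, whose first morphism
is a kernel of `g`. Uniqueness of kernels replaces it by `f`. -/
theorem exists_dist_of_shortExact {M E N : HeartCat t} {f : M ⟶ E} {g : E ⟶ N} {w : f ≫ g = 0}
    (h : (ShortComplex.mk f g w).ShortExact) :
    ∃ δ : N.obj ⟶ M.obj⟦(1 : ℤ)⟧, Triangle.mk f.hom g.hom δ ∈ distTriang C := by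
  let _ := heartAbelian t
  have := h.epi_g
  have := h.mono_f
  dsimp only at *
  obtain ⟨M', i, δ, hT⟩ := AbelianSubcategory.exists_distinguished_triangle_of_epi
    (heart_hom_shift_eq_zero t) (heart_admissibleMorphism t) g
  have hk := AbelianSubcategory.isLimitKernelForkOfDistTriang (heart_hom_shift_eq_zero t) i g δ hT
  let e : M ≅ M' := IsLimit.conePointUniqueUpToIso h.exact.fIsKernel hk
  have he : e.hom ≫ i = f := IsLimit.conePointUniqueUpToIso_hom_comp h.exact.fIsKernel hk
    WalkingParallelPair.zero
  let e' : M.obj ≅ M'.obj := t.heart.ι.mapIso e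
  have he' : e'.hom ≫ i.hom = f.hom := congrArg InducedCategory.Hom.hom he
  refine ⟨δ ≫ e'.inv⟦(1 : ℤ)⟧', isomorphic_distinguished _ hT _
    (Triangle.isoMk _ _ e' (Iso.refl _) (Iso.refl _) ?_ ?_ ?_)⟩
  · change f.hom ≫ 𝟙 E.obj = e'.hom ≫ i.hom; rw [he']; simp
  · change g.hom ≫ 𝟙 N.obj = 𝟙 E.obj ≫ g.hom; simp
  · change (δ ≫ e'.inv⟦(1 : ℤ)⟧') ≫ e'.hom⟦(1 : ℤ)⟧' = 𝟙 N.obj ≫ δ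
    rw [Category.assoc, ← Functor.map_comp, e'.inv_hom_id]; simp

end Heart

/-! ### Comparison of phases -/

theorem ev_sub (f g : ConvLaurent ℝ) : ∀ᶠ v in atTop, ev (f - g) v = ev f v - ev g v := by
  filter_upwards [ev_add f (-g)] with v h
  rw [sub_eq_add_neg, h, ev_neg, sub_eq_add_neg]

theorem nonneg_iff_eventually (f : ConvLaurent ℝ) : 0 ≤ f ↔ ∀ᶠ v in atTop, 0 ≤ ev f v := by
  change (∀ᶠ v in atTop, ev 0 v ≤ ev f v) ↔ _
  simp only [ev_zero]

/-- A nonzero convergent Laurent series has constant sign near infinity. For arbitrary germs, `≤`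
and `≠` would not give an eventual strict inequality. -/
theorem pos_iff_eventually (f : ConvLaurent ℝ) : 0 < f ↔ ∀ᶠ v in atTop, 0 < ev f v := by
  constructor
  · intro h
    refine (eventually_sign h.ne').resolve_right fun h2 => ?_
    obtain ⟨v, h3, h4⟩ := (h2.and ((nonneg_iff_eventually f).1 h.le)).exists
    exact absurd h4 (not_le.2 h3)
  · intro h
    refine lt_of_le_of_ne ((nonneg_iff_eventually f).2 (h.mono fun v hv => hv.le)) ?_
    rintro rfl
    obtain ⟨v, hv⟩ := h.exists
    simp [ev_zero] at hv

/-- The determinant `(Re f)(Im g) - (Im f)(Re g)`. -/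
def cross (f g : ConvLaurent ℂ) : ConvLaurent ℝ := reL f * imL g - imL f * reL g

theorem ev_cross (f g : ConvLaurent ℂ) : ∀ᶠ v in atTop,
    ev (cross f g) v = (ev f v).re * (ev g v).im - (ev f v).im * (ev g v).re := by
  filter_upwards [ev_sub (reL f * imL g) (imL f * reL g), ev_mul (reL f) (imL g),
    ev_mul (imL f) (reL g), ev_re f, ev_im f, ev_re g, ev_im g] with v h1 h2 h3 h4 h5 h6 h7
  rw [cross, h1, h2, h3, h4, h5, h6, h7]

theorem OnRay.cross_eq {z w : ℂ} {x y : ℝ} (hz : OnRay z x) (hw : OnRay w y) :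
    ∃ c : ℝ, 0 < c ∧ z.re * w.im - z.im * w.re = c * Real.sin (Real.pi * (y - x)) := by
  obtain ⟨c, hc, rfl⟩ := hz
  obtain ⟨d, hd, rfl⟩ := hw
  refine ⟨c * d, mul_pos hc hd, ?_⟩
  rw [← Complex.ofReal_mul, ← Complex.ofReal_mul, mul_sub, Real.sin_sub]
  simp only [Complex.re_ofReal_mul, Complex.im_ofReal_mul, Complex.exp_ofReal_mul_I_re,
    Complex.exp_ofReal_mul_I_im]
  ring

/-- The determinant is a positive multiple of `sin (π (y - x))`, which has the sign of `y - x`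
because `|y - x| < 1`. Two points of a half-open interval of length one always satisfy this bound.
-/
theorem OnRay.cross_pos_iff {z w : ℂ} {x y : ℝ} (hz : OnRay z x) (hw : OnRay w y)
    (h1 : y - x < 1) (h2 : x - y < 1) : 0 < z.re * w.im - z.im * w.re ↔ x < y := by
  obtain ⟨c, hc, h⟩ := hz.cross_eq hw
  rw [h, mul_pos_iff_of_pos_left hc]
  have hpi := Real.pi_pos
  constructor
  · intro hs
    by_contra hle
    refine absurd hs (not_lt.2 (Real.sin_nonpos_of_nonpos_of_neg_pi_le ?_ ?_))
    · exact mul_nonpos_of_nonneg_of_nonpos hpi.le (by linarith)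
    · nlinarith
  · intro hs
    exact Real.sin_pos_of_pos_of_lt_pi (mul_pos hpi (by linarith)) (by nlinarith)

theorem OnRay.cross_nonneg_iff {z w : ℂ} {x y : ℝ} (hz : OnRay z x) (hw : OnRay w y)
    (h1 : y - x < 1) (h2 : x - y < 1) : 0 ≤ z.re * w.im - z.im * w.re ↔ x ≤ y := by
  have h := hw.cross_pos_iff hz h2 h1
  rw [← not_lt, ← not_lt, ← h]
  constructor <;> intro h' h'' <;> apply h' <;> linarith

theorem OnRay.add_int {z : ℂ} {θ : ℝ} (h : OnRay z θ) (k : ℤ) :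
    OnRay ((k.negOnePow : ℤ) • z) (θ + k) := by
  rcases Int.even_or_odd' k with ⟨n, rfl | rfl⟩
  · simpa [Int.negOnePow_even _ (even_two_mul n)] using h.add_even n
  · rw [Int.negOnePow_odd _ ⟨n, rfl⟩]
    have := h.add_even n
    obtain ⟨c, hc, rfl⟩ := this
    refine ⟨c, hc, ?_⟩
    have e : (Real.pi : ℂ) * ((θ + ((2 * n + 1 : ℤ) : ℝ) : ℝ) : ℂ) * Complex.I =
        Real.pi * ((θ + 2 * n : ℝ) : ℂ) * Complex.I + Real.pi * Complex.I := by
      push_cast; ring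
    rw [e, Complex.exp_add, Complex.exp_pi_mul_I]
    simp

/-! ### Phases through the determinant pairing, and phases in two interlacing intervals -/

section Phases

variable {C : Type w₂} [Category.{w₁} C] [Preadditive C] [HasZeroObject C] [HasShift C ℤ]
  [∀ n : ℤ, (shiftFunctor C n).Additive] [Pretriangulated C]

/-- The alternating pairing on the Grothendieck group determined by a central charge. -/
def pairing (Z : K0 C →+ ConvLaurent ℂ) : K0 C →+ K0 C →+ ConvLaurent ℝ :=
  AddMonoidHom.mk'
    (fun x => (AddMonoidHom.mulLeft (reL (Z x))).comp (imL.comp Z) -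
      (AddMonoidHom.mulLeft (imL (Z x))).comp (reL.comp Z))
    (fun x y => by
      refine AddMonoidHom.ext fun z => ?_
      simp only [map_add, AddMonoidHom.sub_apply, AddMonoidHom.comp_apply, AddMonoidHom.add_apply,
        AddMonoidHom.coe_mulLeft]
      ring)

theorem pairing_apply (Z : K0 C →+ ConvLaurent ℂ) (x y : K0 C) :
    pairing Z x y = cross (Z x) (Z y) := rfl

theorem pairing_self (Z : K0 C →+ ConvLaurent ℂ) (x : K0 C) : pairing Z x x = 0 := by
  rw [pairing_apply, cross, mul_comm, sub_self]

theorem weight_apply (Z : K0 C →+ ConvLaurent ℂ) (M : C) (x : K0 C) :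
    weight Z M x = cross (Z (K0.mk M)) (Z x) := by
  simp only [weight, cross, AddMonoidHom.add_apply, AddMonoidHom.comp_apply,
    AddMonoidHom.coe_mulLeft]
  ring

variable {t t' : TStructure C} {Z : K0 C →+ ConvLaurent ℂ} {a c : PhaseFn}

theorem exists_phase_rep (hZ : IsPolyStabFun t Z a) {α : ℝ → ℝ} (hα : (α : RealGerm) = a)
    {E : C} (hE : t.heart E) (hE0 : ¬ IsZero E) :
    ∃ q : ℝ → ℝ, phase Z a E = (q : RealGerm) ∧
      ∀ᶠ v in atTop, q v ∈ Set.Ioc (α v) (α v + 1) ∧ OnRay (ev (Z (K0.mk E)) v) (q v) := by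
  refine ⟨fun v => toIocMod (two_pos : (0 : ℝ) < 2) (α v)
    (Complex.arg (ev (Z (K0.mk E)) v) / Real.pi), by rw [phase, ← hα]; rfl, ?_⟩
  have h := hZ E hE hE0
  rw [← hα] at h
  have h' : ∀ᶠ v in atTop, ev (Z (K0.mk E)) v ∈ halfPlane (α v) := h
  filter_upwards [h'] with v hv using toIocMod_spec hv

/-- An angle is determined modulo `2`, and the interval has length `1`, so a representative in the
interval is unique. -/
theorem phase_eq {α q : ℝ → ℝ} (hα : (α : RealGerm) = a) {E : C}
    (h : ∀ᶠ v in atTop, q v ∈ Set.Ioc (α v) (α v + 1) ∧ OnRay (ev (Z (K0.mk E)) v) (q v)) :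
    phase Z a E = (q : RealGerm) := by
  rw [phase, ← hα]
  refine Germ.coe_eq.2 ?_
  filter_upwards [h] with v ⟨h1, h2⟩
  obtain ⟨k, hk⟩ := h2.exists_int (onRay_arg h2.ne_zero)
  rw [toIocMod_eq_iff]
  refine ⟨⟨h1.1, by linarith [h1.2]⟩, k, ?_⟩
  rw [hk, zsmul_eq_mul]; ring

theorem exists_rep (φ : RealGerm) : ∃ α : ℝ → ℝ, (α : RealGerm) = φ :=
  Quotient.exists_rep φ

/-- Turns comparison of phases into a sign on the Grothendieck group, where it can be computed
additively along triangles. -/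
theorem phase_le_iff (hZ : IsPolyStabFun t Z a) {E F : C} (hE : t.heart E) (hE0 : ¬ IsZero E)
    (hF : t.heart F) (hF0 : ¬ IsZero F) :
    phase Z a E ≤ phase Z a F ↔ 0 ≤ pairing Z (K0.mk E) (K0.mk F) := by
  obtain ⟨α, hα⟩ := exists_rep a
  obtain ⟨q, hq, h1⟩ := exists_phase_rep hZ hα hE hE0
  obtain ⟨r, hr, h2⟩ := exists_phase_rep hZ hα hF hF0
  rw [hq, hr, Germ.coe_le, pairing_apply, nonneg_iff_eventually]
  refine eventually_congr ?_
  filter_upwards [h1, h2, ev_cross (Z (K0.mk E)) (Z (K0.mk F))] with v ⟨h1, h1'⟩ ⟨h2, h2'⟩ h3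
  rw [h3, h1'.cross_nonneg_iff h2' (by linarith [h1.1, h2.2]) (by linarith [h1.2, h2.1])]

theorem phase_prec_iff (hZ : IsPolyStabFun t Z a) {E F : C} (hE : t.heart E) (hE0 : ¬ IsZero E)
    (hF : t.heart F) (hF0 : ¬ IsZero F) :
    phase Z a E ≺ phase Z a F ↔ 0 < pairing Z (K0.mk E) (K0.mk F) := by
  obtain ⟨α, hα⟩ := exists_rep a
  obtain ⟨q, hq, h1⟩ := exists_phase_rep hZ hα hE hE0
  obtain ⟨r, hr, h2⟩ := exists_phase_rep hZ hα hF hF0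
  rw [hq, hr, pairing_apply, pos_iff_eventually]
  refine eventually_congr (f := atTop) (p := fun v => q v < r v) ?_
  filter_upwards [h1, h2, ev_cross (Z (K0.mk E)) (Z (K0.mk F))] with v ⟨h1, h1'⟩ ⟨h2, h2'⟩ h3
  rw [h3, h1'.cross_pos_iff h2' (by linarith [h1.1, h2.2]) (by linarith [h1.2, h2.1])]

theorem ev_shift (Z : K0 C →+ ConvLaurent ℂ) (E : C) (n : ℤ) (v : ℝ) :
    ev (Z (K0.mk (E⟦n⟧))) v = (n.negOnePow : ℤ) • ev (Z (K0.mk E)) v := by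
  rw [K0.mk_shift]
  rcases Int.even_or_odd n with h | h
  · simp [Int.negOnePow_even _ h]
  · simp [Int.negOnePow_odd _ h, ev_neg]

/-- If `E` and `E[i]`, `i ∈ {0, 1}`, lie in two hearts with interlacing phase intervals, then their
phases agree up to the shift. -/
theorem phase_rep_of_inDeg (hZ : IsPolyStabFun t Z a) (hZ' : IsPolyStabFun t' Z c)
    {α γ : ℝ → ℝ} (hα : (α : RealGerm) = a) (hγ : (γ : RealGerm) = c)
    (hαγ : ∀ᶠ v in atTop, α v < γ v ∧ γ v < α v + 1) {i : ℤ} (hi : i = 0 ∨ i = 1) {E : C}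
    (hE : t.heart E) (hE' : InDeg t' i E) (hE0 : ¬ IsZero E) :
    ∃ q : ℝ → ℝ, phase Z a E = (q : RealGerm) ∧
      phase Z c (E⟦i⟧) = ((fun v => q v + i : ℝ → ℝ) : RealGerm) ∧
      ∀ᶠ v in atTop, q v + i ∈ Set.Ioc (γ v) (γ v + 1) := by
  obtain ⟨q, hq, h1⟩ := exists_phase_rep hZ hα hE hE0
  have hEi : t'.heart (E⟦i⟧) := (heart_shift_iff t' E i).2 hE'
  obtain ⟨r, hr, h2⟩ := exists_phase_rep hZ' hγ hEi fun h => hE0 ((isZero_shift_iff _ _).1 h)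
  have h3 : ∀ᶠ v in atTop, r v = q v + i := by
    filter_upwards [h1, h2, hαγ] with v ⟨⟨h1, h1'⟩, h1''⟩ ⟨⟨h2, h2'⟩, h2''⟩ ⟨h3, h4⟩
    rw [ev_shift] at h2''
    obtain ⟨k, hk⟩ := (h1''.add_int i).exists_int h2''
    -- The interlacing gives `-1 < r v - q v < 2`, and this difference is `i + 2 k` with `i ∈ {0,
    -- 1}`.
    have hk0 : k = 0 := by
      have l1 : (k : ℝ) < 1 := by rcases hi with rfl | rfl <;> push_cast at hk <;> linarith
      have l2 : (-1 : ℝ) < k := by rcases hi with rfl | rfl <;> push_cast at hk <;> linarith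
      have l1' : k < 1 := by exact_mod_cast l1
      have l2' : -1 < k := by exact_mod_cast l2
      lia
    rw [hk, hk0]; simp
  refine ⟨q, hq, ?_, ?_⟩
  · rw [hr]; exact Germ.coe_eq.2 h3
  · filter_upwards [h2, h3] with v h h'
    rw [← h']; exact h.1

theorem phase_shift_of_inDeg (hZ : IsPolyStabFun t Z a) (hZ' : IsPolyStabFun t' Z c)
    (hac : (a : RealGerm) ≺ c) (hca : (c : RealGerm) ≺ (a : RealGerm) + 1)
    {i : ℤ} (hi : i = 0 ∨ i = 1) {E : C}
    (hE : t.heart E) (hE' : InDeg t' i E) (hE0 : ¬ IsZero E) :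
    phase Z c (E⟦i⟧) = phase Z a E + ((i : ℝ) : RealGerm) := by
  obtain ⟨α, hα⟩ := exists_rep a
  obtain ⟨γ, hγ⟩ := exists_rep c
  rw [← hα, ← hγ] at hac hca
  obtain ⟨q, hq, h, -⟩ := phase_rep_of_inDeg hZ hZ' hα hγ (hac.and hca) hi hE hE' hE0
  rw [h, hq]; rfl

theorem prec_phase_of_inDeg_zero (hZ : IsPolyStabFun t Z a) (hZ' : IsPolyStabFun t' Z c)
    (hac : (a : RealGerm) ≺ c) (hca : (c : RealGerm) ≺ (a : RealGerm) + 1) {E : C}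
    (hE : t.heart E) (hE' : InDeg t' 0 E) (hE0 : ¬ IsZero E) :
    (c : RealGerm) ≺ phase Z a E := by
  obtain ⟨α, hα⟩ := exists_rep a
  obtain ⟨γ, hγ⟩ := exists_rep c
  rw [← hα, ← hγ] at hac hca
  obtain ⟨q, hq, -, h⟩ := phase_rep_of_inDeg hZ hZ' hα hγ (hac.and hca) (Or.inl rfl) hE hE' hE0
  rw [hq, ← hγ]
  change ∀ᶠ v in atTop, γ v < q v
  filter_upwards [h] with v hv
  simpa using hv.1

/-- `E[1]` lies in the second heart, so the phase of `E` plus one is at most `c + 1`. -/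
theorem phase_le_of_inDeg_one (hZ : IsPolyStabFun t Z a) (hZ' : IsPolyStabFun t' Z c)
    (hac : (a : RealGerm) ≺ c) (hca : (c : RealGerm) ≺ (a : RealGerm) + 1) {E : C}
    (hE : t.heart E) (hE' : InDeg t' 1 E) (hE0 : ¬ IsZero E) :
    phase Z a E ≤ (c : RealGerm) := by
  obtain ⟨α, hα⟩ := exists_rep a
  obtain ⟨γ, hγ⟩ := exists_rep c
  rw [← hα, ← hγ] at hac hca
  obtain ⟨q, hq, -, h⟩ := phase_rep_of_inDeg hZ hZ' hα hγ (hac.and hca) (Or.inr rfl) hE hE' hE0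
  rw [hq, ← hγ]
  refine Germ.coe_le.2 ?_
  filter_upwards [h] with v hv
  simpa using hv.2

theorem Prec.of_le_of_prec {φ ψ χ : RealGerm} (h1 : φ ≤ ψ) (h2 : ψ ≺ χ) : φ ≺ χ := by
  obtain ⟨f, rfl⟩ := exists_rep φ
  obtain ⟨g, rfl⟩ := exists_rep ψ
  obtain ⟨k, rfl⟩ := exists_rep χ
  have h1' : ∀ᶠ v in atTop, f v ≤ g v := h1
  have h2' : ∀ᶠ v in atTop, g v < k v := h2
  change ∀ᶠ v in atTop, f v < k v
  filter_upwards [h1', h2'] with v h h' using h.trans_lt h'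

theorem pairing_pos_of_inDeg (hZ : IsPolyStabFun t Z a) (hZ' : IsPolyStabFun t' Z c)
    (hac : (a : RealGerm) ≺ c) (hca : (c : RealGerm) ≺ (a : RealGerm) + 1) {X Y : C}
    (hX : t.heart X) (hX' : InDeg t' 0 X) (hX0 : ¬ IsZero X)
    (hY : t.heart Y) (hY' : InDeg t' 1 Y) (hY0 : ¬ IsZero Y) :
    0 < pairing Z (K0.mk Y) (K0.mk X) :=
  (phase_prec_iff hZ hY hY0 hX hX0).1 (Prec.of_le_of_prec
    (phase_le_of_inDeg_one hZ hZ' hac hca hY hY' hY0) (prec_phase_of_inDeg_zero hZ hZ' hac hca hX hX' hX0))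

/-- The shifts by `m` and `m - 1` bring `X` and `L` into the heart, on opposite sides of `c`. Their
parities differ, and the resulting sign is absorbed by exchanging the arguments. -/
theorem isPositive_pairing (hZ : IsPolyStabFun t Z a) (hZ' : IsPolyStabFun t' Z c)
    (hac : (a : RealGerm) ≺ c) (hca : (c : RealGerm) ≺ (a : RealGerm) + 1) :
    IsPositive t t' 0 (pairing Z) := by
  intro m X L h1 h2 h3 h4 hX hL
  rw [add_zero] at h2 h4
  have h := pairing_pos_of_inDeg hZ hZ' hac hca (X := X⟦m⟧) (Y := L⟦m - 1⟧)
    ((heart_shift_iff t X m).2 h1) ((inDeg_shift_iff t' X m m 0 (by lia)).2 h2)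
    (fun h0 => hX ((isZero_shift_iff _ _).1 h0)) ((heart_shift_iff t L (m - 1)).2 h3)
    ((inDeg_shift_iff t' L m (m - 1) 1 (by lia)).2 h4)
    (fun h0 => hL ((isZero_shift_iff _ _).1 h0))
  rw [K0.mk_shift, K0.mk_shift, Int.negOnePow_sub] at h
  rw [pairing_swap (pairing_self Z)]
  rcases Int.even_or_odd m with hm | hm
  · simpa [Int.negOnePow_even _ hm] using h
  · simpa [Int.negOnePow_odd _ hm] using h

variable [IsTriangulated C]

theorem isSemistableInHeart_iff (hZ : IsPolyStabFun t Z a) (E : HeartCat t) :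
    IsSemistableInHeart t Z a E ↔ SemistableFor t (pairing Z) (0 ≤ ·) 0 E.obj := by
  constructor
  · rintro ⟨h0, h⟩
    refine ⟨inDeg_zero_obj t E, fun h' => h0 ((isZero_obj_iff t E).1 h'),
      fun M N f g δ hT hM hN hM0 hN0 => ?_⟩
    let M' : HeartCat t := ⟨M, (heart_iff_inDeg t M).2 hM⟩
    let N' : HeartCat t := ⟨N, (heart_iff_inDeg t N).2 hN⟩
    refine (phase_le_iff hZ M'.property hM0 N'.property hN0).1 ?_
    exact h (M := M') (N := N') (ObjectProperty.homMk f) (ObjectProperty.homMk g)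
      (ObjectProperty.hom_ext _ (comp_distTriang_mor_zero₁₂ _ hT))
      (shortExact_of_dist t (M := M') (E := E) (N := N') (f := ObjectProperty.homMk f)
        (g := ObjectProperty.homMk g) _ hT)
      (fun h' => hM0 ((isZero_obj_iff t M').2 h')) (fun h' => hN0 ((isZero_obj_iff t N').2 h'))
  · rintro ⟨-, h0, h⟩
    refine ⟨fun h' => h0 ((isZero_obj_iff t E).2 h'), fun M N f g w hS hM0 hN0 => ?_⟩
    obtain ⟨δ, hT⟩ := exists_dist_of_shortExact t hS
    rw [← isZero_obj_iff] at hM0 hN0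
    exact (phase_le_iff hZ M.property hM0 N.property hN0).2
      (h _ _ δ hT (inDeg_zero_obj t M) (inDeg_zero_obj t N) hM0 hN0)

theorem isStableInHeart_iff (hZ : IsPolyStabFun t Z a) (E : HeartCat t) :
    IsStableInHeart t Z a E ↔ SemistableFor t (pairing Z) (0 < ·) 0 E.obj := by
  constructor
  · rintro ⟨h0, h⟩
    refine ⟨inDeg_zero_obj t E, fun h' => h0 ((isZero_obj_iff t E).1 h'),
      fun M N f g δ hT hM hN hM0 hN0 => ?_⟩
    let M' : HeartCat t := ⟨M, (heart_iff_inDeg t M).2 hM⟩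
    let N' : HeartCat t := ⟨N, (heart_iff_inDeg t N).2 hN⟩
    refine (phase_prec_iff hZ M'.property hM0 N'.property hN0).1 ?_
    exact h (M := M') (N := N') (ObjectProperty.homMk f) (ObjectProperty.homMk g)
      (ObjectProperty.hom_ext _ (comp_distTriang_mor_zero₁₂ _ hT))
      (shortExact_of_dist t (M := M') (E := E) (N := N') (f := ObjectProperty.homMk f)
        (g := ObjectProperty.homMk g) _ hT)
      (fun h' => hM0 ((isZero_obj_iff t M').2 h')) (fun h' => hN0 ((isZero_obj_iff t N').2 h'))
  · rintro ⟨-, h0, h⟩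
    refine ⟨fun h' => h0 ((isZero_obj_iff t E).2 h'), fun M N f g w hS hM0 hN0 => ?_⟩
    obtain ⟨δ, hT⟩ := exists_dist_of_shortExact t hS
    rw [← isZero_obj_iff] at hM0 hN0
    exact (phase_prec_iff hZ M.property hM0 N.property hN0).2
      (h _ _ δ hT (inDeg_zero_obj t M) (inDeg_zero_obj t N) hM0 hN0)

theorem isSemistable_iff (hZ : IsPolyStabFun t Z a) (E : C) :
    IsSemistable t Z a E ↔ ∃ n, SemistableFor t (pairing Z) (0 ≤ ·) n E := by
  refine exists_congr fun n => ⟨fun ⟨h, hs⟩ => ?_, fun hs => ?_⟩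
  · exact (semistableFor_shift_iff E n n 0 (add_zero n)).1 ((isSemistableInHeart_iff hZ _).1 hs)
  · exact ⟨(heart_shift_iff t E n).2 hs.1, (isSemistableInHeart_iff hZ _).2
      ((semistableFor_shift_iff E n n 0 (add_zero n)).2 hs)⟩

theorem isStable_iff (hZ : IsPolyStabFun t Z a) (E : C) :
    IsStable t Z a E ↔ ∃ n, SemistableFor t (pairing Z) (0 < ·) n E := by
  refine exists_congr fun n => ⟨fun ⟨h, hs⟩ => ?_, fun hs => ?_⟩
  · exact (semistableFor_shift_iff E n n 0 (add_zero n)).1 ((isStableInHeart_iff hZ _).1 hs)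
  · exact ⟨(heart_shift_iff t E n).2 hs.1, (isStableInHeart_iff hZ _).2
      ((semistableFor_shift_iff E n n 0 (add_zero n)).2 hs)⟩

end Phases

/-! ### The torsion pair of a tilt and the refinement properties -/

section Refinement

variable {C : Type w₂} [Category.{w₁} C] [Preadditive C] [HasZeroObject C] [HasShift C ℤ]
  [∀ n : ℤ, (shiftFunctor C n).Additive] [Pretriangulated C] [IsTriangulated C]
  {t t' : TStructure C} {T F : ObjectProperty (HeartCat t)}

theorem exists_shortExact_of_isTilt (h : IsTilt t t' 0) (h' : IsTilt t' t (-0 - 1))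
    (hT : ∀ E, T E ↔ InDeg t' 0 E.obj) (hF : ∀ E, F E ↔ InDeg t' 1 E.obj) (E : HeartCat t) :
    ∃ (X Y : HeartCat t) (f : X ⟶ E) (g : E ⟶ Y) (w : f ≫ g = 0),
      T X ∧ F Y ∧ (ShortComplex.mk f g w).ShortExact := by
  obtain ⟨L, J, f, g, δ, hD, hL, hL', hJ, hJ'⟩ := h.exists_triangle h' (inDeg_zero_obj t E)
  let X : HeartCat t := ⟨L, (heart_iff_inDeg t L).2 hL⟩
  let Y : HeartCat t := ⟨J, (heart_iff_inDeg t J).2 hJ⟩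
  exact ⟨X, Y, ObjectProperty.homMk f, ObjectProperty.homMk g,
    ObjectProperty.hom_ext _ (comp_distTriang_mor_zero₁₂ _ hD), (hT X).2 hL', (hF Y).2 hJ',
    shortExact_of_dist t (M := X) (E := E) (N := Y) (f := ObjectProperty.homMk f)
      (g := ObjectProperty.homMk g) _ hD⟩

theorem isTorsionPair_of_isTilt (h : IsTilt t t' 0) (h' : IsTilt t' t (-0 - 1))
    (hT : ∀ E, T E ↔ InDeg t' 0 E.obj) (hF : ∀ E, F E ↔ InDeg t' 1 E.obj) :
    IsTorsionPair T F :=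
  ⟨fun X Y hX hY f => ObjectProperty.hom_ext _
    (t'.zero_of_isLE_of_isGE f.hom 0 1 one_pos ((hT X).1 hX).1 ((hF Y).1 hY).2),
    exists_shortExact_of_isTilt h h' hT hF⟩

theorem K0.mk_of_shortExact {X E Y : HeartCat t} {f : X ⟶ E} {g : E ⟶ Y} {w : f ≫ g = 0}
    (h : (ShortComplex.mk f g w).ShortExact) :
    K0.mk E.obj = K0.mk X.obj + K0.mk Y.obj := by
  obtain ⟨δ, hD⟩ := exists_dist_of_shortExact t h
  exact K0.mk_triangle hD

omit [IsTriangulated C] in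
theorem isZero_of_shortExact_of_isIso {X E Y : HeartCat t} {f : X ⟶ E} {g : E ⟶ Y}
    {w : f ≫ g = 0} (h : (ShortComplex.mk f g w).ShortExact) [IsIso f] : IsZero Y := by
  have := h.epi_g
  dsimp only at this
  rw [IsZero.iff_id_eq_zero, ← cancel_epi g, ← cancel_epi f, reassoc_of% w]
  simp

theorem nonempty_obj_iso_of_shortExact_of_isZero_left {X E Y : HeartCat t} {f : X ⟶ E} {g : E ⟶ Y}
    {w : f ≫ g = 0} (h : (ShortComplex.mk f g w).ShortExact) (hX : IsZero X) :
    Nonempty (E.obj ≅ Y.obj) := by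
  obtain ⟨δ, hD⟩ := exists_dist_of_shortExact t h
  have : IsIso g.hom := (Triangle.isZero₁_iff_isIso₂ _ hD).1 ((isZero_obj_iff t X).2 hX)
  exact ⟨asIso g.hom⟩

theorem nonempty_obj_iso_of_shortExact_of_isZero_right {X E Y : HeartCat t} {f : X ⟶ E} {g : E ⟶ Y}
    {w : f ≫ g = 0} (h : (ShortComplex.mk f g w).ShortExact) (hY : IsZero Y) :
    Nonempty (X.obj ≅ E.obj) := by
  obtain ⟨δ, hD⟩ := exists_dist_of_shortExact t h
  have : IsIso f.hom := (Triangle.isZero₃_iff_isIso₁ _ hD).1 ((isZero_obj_iff t Y).2 hY)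
  exact ⟨asIso f.hom⟩

variable {R : Type} [AddCommGroup R] [LinearOrder R] [IsOrderedAddMonoid R] {S : K0 C →+ R}

/-- If the torsion-free part `Y` of an `S`-semistable `E` were nonzero, `S(Y) < 0` and `S(E) = 0`
would make `S` positive on the torsion part, which is a nonzero proper subobject. -/
theorem refinement0_of_isTilt (h : IsTilt t t' 0) (h' : IsTilt t' t (-0 - 1))
    (hT : ∀ E, T E ↔ InDeg t' 0 E.obj) (hF : ∀ E, F E ↔ InDeg t' 1 E.obj)
    (hS : ∀ G, F G → ¬ IsZero G → S (K0.mk G.obj) < 0) : Refinement0 t S T F := by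
  refine ⟨fun E hE => ?_, hS⟩
  obtain ⟨X, Y, f, g, w, hX, hY, hXY⟩ := exists_shortExact_of_isTilt h h' hT hF E
  by_cases hY0 : IsZero Y
  · obtain ⟨e⟩ := nonempty_obj_iso_of_shortExact_of_isZero_right hXY hY0
    exact (hT E).2 (((hT X).1 hX).of_iso e)
  exfalso
  have hsum := congrArg S (K0.mk_of_shortExact hXY)
  rw [hE.2.1, map_add] at hsum
  have hYneg := hS Y hY hY0
  have hXpos : 0 < S (K0.mk X.obj) := by
    rw [eq_neg_of_add_eq_zero_left hsum.symm]
    exact neg_pos.2 hYneg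
  refine absurd (hE.2.2 f hXY.mono_f (fun hX0 => ?_) fun _ => ?_) (not_le.2 hXpos)
  · rw [K0.mk_isZero ((isZero_obj_iff t X).2 hX0), map_zero] at hXpos
    exact lt_irrefl _ hXpos
  · exact hY0 (isZero_of_shortExact_of_isIso hXY)

omit [IsOrderedAddMonoid R] in
-- A nonzero torsion part of an `S`-semistable `E` has positive weight. If proper, it destabilizes
-- `E`; if it is all of `E`, it contradicts `S(E) = 0`.
theorem refinement1_of_isTilt (h : IsTilt t t' 0) (h' : IsTilt t' t (-0 - 1))
    (hT : ∀ E, T E ↔ InDeg t' 0 E.obj) (hF : ∀ E, F E ↔ InDeg t' 1 E.obj)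
    (hS : ∀ G, T G → ¬ IsZero G → 0 < S (K0.mk G.obj)) : Refinement1 t S T F := by
  refine ⟨fun E hE => ?_, hS⟩
  obtain ⟨X, Y, f, g, w, hX, hY, hXY⟩ := exists_shortExact_of_isTilt h h' hT hF E
  by_cases hX0 : IsZero X
  · obtain ⟨e⟩ := nonempty_obj_iso_of_shortExact_of_isZero_left hXY hX0
    exact (hF E).2 (((hF Y).1 hY).of_iso e.symm)
  exfalso
  have hXpos := hS X hX hX0
  by_cases hY0 : IsZero Y
  · obtain ⟨e⟩ := nonempty_obj_iso_of_shortExact_of_isZero_right hXY hY0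
    rw [K0.mk_eq_of_iso e, hE.2.1] at hXpos
    exact lt_irrefl _ hXpos
  · exact absurd (hE.2.2 f hXY.mono_f hX0 fun _ => hY0 (isZero_of_shortExact_of_isIso hXY))
      (not_le.2 hXpos)

end Refinement

/-- Multiplication by `u` scales the determinant by `|u|²`. This removes the normalizing factor
`e^{iπ(-a)}` from the weight function. -/
theorem cross_mul_left_of_norm_one {u : ConvLaurent ℂ} (hu : ∀ᶠ v in atTop, ‖ev u v‖ = 1)
    (f g : ConvLaurent ℂ) : cross (u * f) (u * g) = cross f g := by
  have key : ∀ᶠ v in atTop, ev (cross (u * f) (u * g)) v = ev (cross f g) v := by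
    filter_upwards [hu, ev_cross (u * f) (u * g), ev_cross f g, ev_mul u f, ev_mul u g]
      with v h1 h2 h3 h4 h5
    rw [h2, h3, h4, h5]
    have h6 : (ev u v).re * (ev u v).re + (ev u v).im * (ev u v).im = 1 := by
      rw [← Complex.normSq_apply, Complex.normSq_eq_norm_sq, h1, one_pow]
    simp only [Complex.mul_re, Complex.mul_im]
    linear_combination ((ev f v).re * (ev g v).im - (ev f v).im * (ev g v).re) * h6
  exact le_antisymm (key.mono fun v h => h.le) (key.mono fun v h => h.ge)

/-! ### Normalization by the initial phase -/

theorem analyticAt_tsum_of_summable {b : ℕ → ℂ} {ρ : ℝ} (hρ : 0 < ρ)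
    (h : Summable fun n => ‖b n‖ * ρ ^ n) : AnalyticAt ℂ (fun w => ∑' n, b n * w ^ n) 0 := by
  set p := FormalMultilinearSeries.ofScalars ℂ b with hp
  obtain ⟨ρ, rfl⟩ : ∃ r : NNReal, (r : ℝ) = ρ := ⟨⟨ρ, hρ.le⟩, rfl⟩
  have hr : (ρ : ENNReal) ≤ p.radius := by
    refine p.le_radius_of_summable_norm (h.congr fun n => ?_)
    rw [hp, FormalMultilinearSeries.ofScalars_norm]
  have hpos : 0 < p.radius := lt_of_lt_of_le (by exact_mod_cast hρ) hr
  have := (p.hasFPowerSeriesOnBall hpos).analyticAt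
  have e : p.sum = fun w => ∑' n, b n * w ^ n := by
    ext w
    simp [hp, FormalMultilinearSeries.sum, FormalMultilinearSeries.ofScalars]
  rwa [e] at this

/-- The Taylor series at `w = 0`, read as a Laurent series in `w = 1/v` without negative powers. -/
theorem exists_convLaurent_of_analyticAt {h : ℂ → ℂ} (hh : AnalyticAt ℂ h 0) :
    ∃ u : ConvLaurent ℂ, ∀ᶠ v : ℝ in atTop, ev u v = h ((v⁻¹ : ℝ) : ℂ) := by
  obtain ⟨p, r, hp⟩ := hh
  obtain ⟨s, hs0, hsr⟩ := ENNReal.lt_iff_exists_nnreal_btwn.1 hp.r_pos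
  have hs0' : (0 : ℝ) < s := by exact_mod_cast hs0
  set F : LaurentSeries ℂ := HahnSeries.ofPowerSeries ℤ ℂ (PowerSeries.mk p.coeff) with hF
  have hcoe : ∀ n : ℕ, F.coeff n = p.coeff n := fun n => by
    rw [hF, HahnSeries.ofPowerSeries_apply_coeff, PowerSeries.coeff_mk]
  have hneg : ∀ k : ℤ, k ∉ Set.range ((↑) : ℕ → ℤ) → F.coeff k = 0 := fun k hk => by
    rw [hF, HahnSeries.ofPowerSeries_apply, HahnSeries.embDomain_of_notMem_range]
    rintro ⟨n, hn⟩
    exact hk ⟨n, hn⟩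
  have key : ∀ w : ℂ, ‖w‖ < s → HasSum (fun k : ℤ => F.coeff k * w ^ k) (h w) := by
    intro w hw
    have h1 := hp.hasSum (y := w) (by
      rw [Metric.mem_eball, edist_zero_right]
      refine lt_trans ?_ hsr
      rw [enorm_eq_nnnorm]
      exact_mod_cast hw)
    rw [zero_add] at h1
    refine (Function.Injective.hasSum_iff (Nat.cast_injective (R := ℤ)) fun k hk => ?_).1 ?_
    · rw [hneg k hk, zero_mul]
    · refine h1.congr_fun fun n => ?_
      simp [hcoe, mul_comm]
  refine ⟨⟨F, s, hs0', fun w _ hw => (key w hw).summable⟩, ?_⟩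
  filter_upwards [eventually_gt_atTop 0, eventually_gt_atTop (s : ℝ)⁻¹] with v h1 h2
  refine (key _ ?_).tsum_eq
  change ‖((v⁻¹ : ℝ) : ℂ)‖ < s
  rw [Complex.norm_real, Real.norm_of_nonneg (by positivity)]
  exact inv_lt_of_inv_lt₀ hs0' h2

/-- A nonzero convergent Laurent series is `w ^ m` times a convergent power series in `w = 1/v`. -/
theorem exists_powerSeries_rep {f : ConvLaurent ℂ} (hf : f ≠ 0) :
    ∃ (m : ℤ) (b : ℕ → ℂ) (ρ : ℝ), 0 < ρ ∧ b 0 ≠ 0 ∧ (Summable fun n => ‖b n‖ * ρ ^ n) ∧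
      ∀ᶠ v : ℝ in atTop, ev f v =
        ((v⁻¹ : ℝ) : ℂ) ^ m * ∑' n, b n * ((v⁻¹ : ℝ) : ℂ) ^ n := by
  have hf' : (f : LaurentSeries ℂ) ≠ 0 := fun h => hf (Subtype.ext h)
  set F : LaurentSeries ℂ := (f : LaurentSeries ℂ) with hF
  obtain ⟨r, hr, hc⟩ := f.2
  have hinj : Function.Injective (fun n : ℕ => F.order + (n : ℤ)) := fun a b h => by
    simpa using h
  set ρ : ℝ := r / 2 with hρ
  have hρ0 : 0 < ρ := by positivity
  have hρK : ((ρ : ℝ) : ℂ) ≠ 0 := by exact_mod_cast hρ0.ne'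
  refine ⟨F.order, fun n => F.coeff (F.order + n), ρ, hρ0, ?_, ?_, ?_⟩
  · simpa using HahnSeries.coeff_order_eq_zero.not.2 hf'
  · have h1 := (hc (ρ : ℂ) hρK (by
      rw [Complex.norm_real, Real.norm_of_nonneg hρ0.le]; linarith)).norm.comp_injective hinj
    have h2 := h1.mul_right (ρ ^ (-F.order))
    refine h2.congr fun n => ?_
    simp only [Function.comp, norm_mul, norm_zpow, Complex.norm_real, Real.norm_of_nonneg hρ0.le]
    rw [mul_assoc, ← zpow_add₀ hρ0.ne', ← zpow_natCast]
    congr 2; ring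
  · filter_upwards [eventually_convergesAt f] with v hv
    rw [ev, ← hF, ← tsum_mul_left, ← hinj.tsum_eq]
    · refine tsum_congr fun n => ?_
      have : ((v⁻¹ : ℝ) : ℂ) ≠ 0 := hv.2.1
      change F.coeff (F.order + n) * ((v⁻¹ : ℝ) : ℂ) ^ (F.order + (n : ℤ)) = _
      rw [zpow_add₀ this, zpow_natCast]
      ring
    · intro k hk
      rw [Function.mem_support] at hk
      have : F.coeff k ≠ 0 := fun h => hk (by simp [h])
      have := HahnSeries.order_le_of_coeff_ne_zero this
      exact ⟨(k - F.order).toNat, by simp [Int.toNat_of_nonneg (sub_nonneg.2 this)]⟩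

/-- Write `f = w ^ m F(w)` with `w = 1/v` and `F(0) ≠ 0`, and let `G` have the conjugate
coefficients, so `G = conj F` on the real axis. For real `w > 0` the factor `w ^ m` is positive, so
`e^{-iπ a} = conj F / |F| = G / √(F G)`. This is analytic at `0`, because `F(0) G(0) = |F(0)|²` is
positive and the principal logarithm defines the square root there. -/
theorem exists_normalization (a : PhaseFn) : ∃ u : ConvLaurent ℂ,
    evGerm u = (a : RealGerm).map
      (fun x : ℝ => Complex.exp (Real.pi * (-x : ℝ) * Complex.I)) := by
  obtain ⟨_, q, rfl, -, f, hf, hq⟩ := a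
  obtain ⟨m, b, ρ, hρ, hb, hsum, hev⟩ := exists_powerSeries_rep hf
  let F : ℂ → ℂ := fun w => ∑' n, b n * w ^ n
  let G : ℂ → ℂ := fun w => ∑' n, (starRingEnd ℂ) (b n) * w ^ n
  have hF : AnalyticAt ℂ F 0 := analyticAt_tsum_of_summable hρ hsum
  have hG : AnalyticAt ℂ G 0 := analyticAt_tsum_of_summable hρ (by simpa using hsum)
  have hF0 : F 0 = b 0 := by
    change ∑' n, b n * 0 ^ n = b 0
    rw [tsum_eq_single 0 (fun n hn => by simp [hn])]; simp
  have hG0 : G 0 = (starRingEnd ℂ) (b 0) := by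
    change ∑' n, (starRingEnd ℂ) (b n) * 0 ^ n = _
    rw [tsum_eq_single 0 (fun n hn => by simp [hn])]; simp
  have hGF : ∀ w : ℝ, G w = (starRingEnd ℂ) (F w) := fun w => by
    change ∑' n, (starRingEnd ℂ) (b n) * (w : ℂ) ^ n = (starRingEnd ℂ) (∑' n, b n * (w : ℂ) ^ n)
    rw [Complex.conj_tsum]
    simp
  have hslit : (F * G) 0 ∈ Complex.slitPlane := by
    rw [Pi.mul_apply, hF0, hG0, Complex.mul_conj]
    exact Complex.ofReal_mem_slitPlane.2 (Complex.normSq_pos.2 hb)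
  have hh : AnalyticAt ℂ (fun w => G w * Complex.exp (-(Complex.log ((F * G) w) / 2))) 0 := by
    refine hG.mul (AnalyticAt.cexp (AnalyticAt.neg ?_))
    exact ((hF.mul hG).clog hslit).div_const
  obtain ⟨u, hu⟩ := exists_convLaurent_of_analyticAt hh
  refine ⟨u, Germ.coe_eq.2 ?_⟩
  filter_upwards [hu, hev, hq, eventually_gt_atTop 0] with v h1 h2 h3 hv
  rw [h1]
  obtain ⟨c, hc, h3⟩ := h3
  have hv' : (0 : ℝ) < v⁻¹ := inv_pos.2 hv
  set w : ℝ := v⁻¹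
  -- `d` is the modulus of `F w`.
  set d : ℝ := c * w ^ (-m) with hd
  have hd0 : 0 < d := by positivity
  have hw : (w : ℂ) ≠ 0 := by exact_mod_cast hv'.ne'
  set e : ℂ := Complex.exp (Real.pi * (q v) * Complex.I) with he
  have hFw : F w = d * e := by
    have h4 : (w : ℂ) ^ m * F w = c * e := by rw [← h2, h3]
    have h5 : F w = (w : ℂ) ^ (-m) * ((w : ℂ) ^ m * F w) := by
      rw [← mul_assoc, ← zpow_add₀ hw]; simp
    rw [h5, h4, hd]; push_cast; ring
  have hee : (starRingEnd ℂ) e = Complex.exp (Real.pi * (-(q v) : ℝ) * Complex.I) := by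
    rw [he, ← Complex.exp_conj]
    congr 1
    simp
  have hme : e * (starRingEnd ℂ) e = 1 := by
    rw [hee, he, ← Complex.exp_add]
    simp
  have hFG : (F * G) w = ((d ^ 2 : ℝ) : ℂ) := by
    rw [Pi.mul_apply, hGF, hFw]
    simp only [map_mul, Complex.conj_ofReal]
    push_cast
    linear_combination (d : ℂ) ^ 2 * hme
  have hexp : Complex.exp (-(Complex.log ((F * G) w) / 2)) = ((d⁻¹ : ℝ) : ℂ) := by
    rw [hFG, ← Complex.ofReal_log (by positivity), Real.log_pow]
    have : -(((2 : ℕ) * Real.log d : ℝ) : ℂ) / 2 = ((-Real.log d : ℝ) : ℂ) := by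
      push_cast; ring
    rw [← neg_div, this, ← Complex.ofReal_exp, Real.exp_neg, Real.exp_log hd0]
  rw [hexp, hGF, hFw, map_mul, Complex.conj_ofReal, hee]
  have hd' : (d : ℂ) ≠ 0 := by exact_mod_cast hd0.ne'
  rw [Complex.ofReal_inv, mul_right_comm, mul_inv_cancel₀ hd', one_mul]
  rfl

/-! ### Change of the central charge along a lifted path -/

namespace GLTilde

/-- The angles of `z` form one class modulo even integers, and `g` commutes with integer
translations; so the angle mapped to `θ` is again an angle of `z`. -/
theorem onRay_symm (x : GLTilde) {z : ℂ} {θ : ℝ}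
    (h : OnRay (matC (x.lin : GL (Fin 2) ℝ) z) θ) : OnRay z (x.gEquiv.symm θ) := by
  have hne : z ≠ 0 := by
    rintro rfl
    apply h.ne_zero
    apply Complex.ext <;> simp [matC]
  have h1 := onRay_arg hne
  obtain ⟨k, hk⟩ := (x.onRay h1).exists_int h
  have h2 : x.gEquiv.symm θ = Complex.arg z / Real.pi + 2 * k := by
    rw [Equiv.symm_apply_eq, hk]
    have := x.map_add_int (Complex.arg z / Real.pi) (2 * k)
    push_cast at this
    exact this.symm
  rw [h2]
  exact h1.add_even k

end GLTilde

namespace LiftedPath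

variable {T : GL (Fin 2) (ConvLaurent ℝ)} (p : LiftedPath T)

/-- The map `φ ↦ (v ↦ g_v(φ(v)))` on all germs. -/
def gMap (φ : RealGerm) : RealGerm :=
  Germ.map₂ (fun x t => x.g t) (p.path : Germ atTop GLTilde) φ

theorem coe_Γ (φ : PhaseFn) : (p.Γ φ : RealGerm) = p.gMap φ := rfl

theorem gMap_coe (q : ℝ → ℝ) : p.gMap (q : RealGerm) = ((fun v => (p.path v).g (q v) : ℝ → ℝ) :
    RealGerm) := rfl

theorem gMap_le_iff (φ ψ : RealGerm) : p.gMap φ ≤ p.gMap ψ ↔ φ ≤ ψ := by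
  obtain ⟨f, rfl⟩ := exists_rep φ
  obtain ⟨g, rfl⟩ := exists_rep ψ
  exact eventually_congr (Eventually.of_forall fun v => (p.path v).strictMono.le_iff_le)

theorem gMap_prec_iff (φ ψ : RealGerm) : p.gMap φ ≺ p.gMap ψ ↔ φ ≺ ψ := by
  obtain ⟨f, rfl⟩ := exists_rep φ
  obtain ⟨g, rfl⟩ := exists_rep ψ
  exact eventually_congr (Eventually.of_forall fun v => (p.path v).strictMono.lt_iff_lt)

theorem gMap_injective : Function.Injective p.gMap := fun φ ψ h =>
  le_antisymm ((p.gMap_le_iff φ ψ).1 h.le) ((p.gMap_le_iff ψ φ).1 h.ge)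

theorem gMap_add_int (φ : RealGerm) (k : ℤ) :
    p.gMap (φ + ((k : ℝ) : RealGerm)) = p.gMap φ + ((k : ℝ) : RealGerm) := by
  obtain ⟨f, rfl⟩ := exists_rep φ
  exact Germ.coe_eq.2 (Eventually.of_forall fun v => (p.path v).map_add_int (f v) k)

section Charge

variable {C : Type w₂} [Category.{w₁} C] [Preadditive C] [HasZeroObject C] [HasShift C ℤ]
  [∀ n : ℤ, (shiftFunctor C n).Additive] [Pretriangulated C]
  {t : TStructure C} {Z : K0 C →+ ConvLaurent ℂ} {b : PhaseFn}

/-- Being increasing and compatible with `x ↦ x + 1`, `g_v` carries `(α v, α v + 1]` onto the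
interval of length one starting at `g_v (α v)`, which represents `b`. Hence `g_v⁻¹` of a phase for
`Z` is a phase for `T⁻¹ Z`. -/
theorem phase_actPath_rep (hZ : IsPolyStabFun t Z b) {α : ℝ → ℝ}
    (hα : (α : RealGerm) = p.Γ.symm b) {E : C} (hE : t.heart E) (hE0 : ¬ IsZero E) :
    ∃ r : ℝ → ℝ, phase Z b E = p.gMap r ∧
      ∀ᶠ v in atTop, r v ∈ Set.Ioc (α v) (α v + 1) ∧
        OnRay (ev (matAct ((T⁻¹ : GL (Fin 2) (ConvLaurent ℝ)) : Matrix (Fin 2) (Fin 2) _)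
          (Z (K0.mk E))) v) (r v) := by
  have hb : ((fun v => (p.path v).g (α v) : ℝ → ℝ) : RealGerm) = b := by
    rw [← p.gMap_coe, hα, ← p.coe_Γ, Equiv.apply_symm_apply]
  obtain ⟨q, hq, h⟩ := exists_phase_rep hZ hb hE hE0
  have hg : ∀ v, (p.path v).g ((p.path v).gEquiv.symm (q v)) = q v := fun v =>
    (p.path v).gEquiv.apply_symm_apply (q v)
  refine ⟨fun v => (p.path v).gEquiv.symm (q v), ?_, ?_⟩
  · rw [hq, p.gMap_coe]
    exact congrArg Germ.ofFun (funext fun v => (hg v).symm)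
  set f' := matAct ((T⁻¹ : GL (Fin 2) (ConvLaurent ℝ)) : Matrix (Fin 2) (Fin 2) _)
    (Z (K0.mk E)) with hf'
  have hTf : matAct (T : Matrix (Fin 2) (Fin 2) (ConvLaurent ℝ)) f' = Z (K0.mk E) := by
    rw [hf', ← matAct_mul, ← Units.val_mul, mul_inv_cancel, Units.val_one, matAct_one]
  filter_upwards [h, ev_matAct (T : Matrix (Fin 2) (Fin 2) (ConvLaurent ℝ)) f',
    eventually_ge_atTop p.v₁] with v ⟨h1, h1'⟩ h2 h3
  rw [hTf, ← p.lift v h3] at h2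
  refine ⟨⟨?_, ?_⟩, (p.path v).onRay_symm (h2 ▸ h1')⟩
  · rw [← (p.path v).strictMono.lt_iff_lt, hg]
    exact h1.1
  · rw [← (p.path v).strictMono.le_iff_le, hg, (p.path v).map_add_one]
    exact h1.2

/-- The central charge `T⁻¹ Z`. -/
abbrev charge (_ : LiftedPath T) (Z : K0 C →+ ConvLaurent ℂ) : K0 C →+ ConvLaurent ℂ :=
  (matAct ((T⁻¹ : GL (Fin 2) (ConvLaurent ℝ)) : Matrix (Fin 2) (Fin 2) (ConvLaurent ℝ))).comp Z

theorem isPolyStabFun_charge (hZ : IsPolyStabFun t Z b) :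
    IsPolyStabFun t (p.charge Z) (p.Γ.symm b) := by
  intro E hE hE0
  obtain ⟨α, hα⟩ := exists_rep (p.Γ.symm b)
  obtain ⟨r, -, hr⟩ := p.phase_actPath_rep hZ hα hE hE0
  rw [← hα]
  change ∀ᶠ v in atTop, ev _ v ∈ halfPlane (α v)
  filter_upwards [hr] with v hv using ⟨r v, hv⟩

/-- All invariance statements below rest on this: the phases for the two charges differ by a
strictly increasing map commuting with integer translations. -/
theorem phase_eq_gMap (hZ : IsPolyStabFun t Z b) {E : C} (hE : t.heart E) (hE0 : ¬ IsZero E) :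
    phase Z b E = p.gMap (phase (p.charge Z) (p.Γ.symm b) E) := by
  obtain ⟨α, hα⟩ := exists_rep (p.Γ.symm b)
  obtain ⟨r, hr, h⟩ := p.phase_actPath_rep hZ hα hE hE0
  rw [hr, phase_eq (Z := p.charge Z) hα h]

theorem isSemistableInHeart_charge_iff (hZ : IsPolyStabFun t Z b) (E : HeartCat t) :
    IsSemistableInHeart t (p.charge Z) (p.Γ.symm b) E ↔ IsSemistableInHeart t Z b E := by
  refine and_congr_right fun _ => forall₅_congr fun M N f g w => forall₃_congr fun _ hM hN => ?_
  rw [← isZero_obj_iff] at hM hN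
  rw [p.phase_eq_gMap hZ M.property hM, p.phase_eq_gMap hZ N.property hN, gMap_le_iff]

theorem isStableInHeart_charge_iff (hZ : IsPolyStabFun t Z b) (E : HeartCat t) :
    IsStableInHeart t (p.charge Z) (p.Γ.symm b) E ↔ IsStableInHeart t Z b E := by
  refine and_congr_right fun _ => forall₅_congr fun M N f g w => forall₃_congr fun _ hM hN => ?_
  rw [← isZero_obj_iff] at hM hN
  rw [p.phase_eq_gMap hZ M.property hM, p.phase_eq_gMap hZ N.property hN, gMap_prec_iff]

theorem isSemistable_charge_iff (hZ : IsPolyStabFun t Z b) (E : C) :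
    IsSemistable t (p.charge Z) (p.Γ.symm b) E ↔ IsSemistable t Z b E :=
  exists_congr fun _ => exists_congr fun _ => p.isSemistableInHeart_charge_iff hZ _

theorem isStable_charge_iff (hZ : IsPolyStabFun t Z b) (E : C) :
    IsStable t (p.charge Z) (p.Γ.symm b) E ↔ IsStable t Z b E :=
  exists_congr fun _ => exists_congr fun _ => p.isStableInHeart_charge_iff hZ _

theorem hasHN_charge (hZ : IsPolyStabFun t Z b) (h : HasHN t Z b) :
    HasHN t (p.charge Z) (p.Γ.symm b) := by
  intro E hE
  obtain ⟨m, X, Q, i, q, w, h1, h2, h3, h4, h5⟩ := h E hE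
  refine ⟨m, X, Q, i, q, w, h1, h2, h3, fun k hk => ⟨(h4 k hk).1,
    (p.isSemistableInHeart_charge_iff hZ _).2 (h4 k hk).2⟩, fun k hk => ?_⟩
  have n1 := (h4 k (by lia)).2.1
  have n2 := (h4 (k + 1) hk).2.1
  rw [← isZero_obj_iff] at n1 n2
  have := h5 k hk
  rwa [p.phase_eq_gMap hZ (Q k).property n1, p.phase_eq_gMap hZ (Q (k + 1)).property n2,
    gMap_prec_iff] at this

theorem slicing_charge_iff (hZ : IsPolyStabFun t Z b) (φ : PhaseFn) (E : C) :
    slicing t (p.charge Z) (p.Γ.symm b) φ E ↔ slicing t Z b (p.Γ φ) E := by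
  refine or_congr_right (exists_congr fun j => exists_congr fun h => ?_)
  rw [p.isSemistableInHeart_charge_iff hZ]
  refine and_congr_right fun hs => ?_
  have h0 := hs.1
  rw [← isZero_obj_iff] at h0
  rw [p.phase_eq_gMap hZ h h0, p.coe_Γ, ← p.gMap_add_int, p.gMap_injective.eq_iff]

end Charge

end LiftedPath

/-! ### Pullback of a t-structure along an exact equivalence -/

section Pullback

variable {C : Type w₂} [Category.{w₁} C] [Preadditive C] [HasZeroObject C] [HasShift C ℤ]
  [∀ n : ℤ, (shiftFunctor C n).Additive] [Pretriangulated C]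
  {D : Type w₄} [Category.{w₃} D] [Preadditive D] [HasZeroObject D] [HasShift D ℤ]
  [∀ n : ℤ, (shiftFunctor D n).Additive] [Pretriangulated D]
  (Φ : C ⥤ D) [Φ.CommShift ℤ] [Φ.IsTriangulated] [Φ.IsEquivalence]

/-- An equivalence lifts the triangle up to isomorphism; full faithfulness then makes the middle
object equal to `E`. Thus exact sequences around `Φ.obj E` all come from `E`. -/
theorem exists_dist_of_dist_obj {E : C} {M N : D} {f : M ⟶ Φ.obj E} {g : Φ.obj E ⟶ N}
    {δ : N ⟶ M⟦(1 : ℤ)⟧} (hT : Triangle.mk f g δ ∈ distTriang D) :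
    ∃ (M' N' : C) (f' : M' ⟶ E) (g' : E ⟶ N') (δ' : N' ⟶ M'⟦(1 : ℤ)⟧),
      Triangle.mk f' g' δ' ∈ distTriang C ∧ Nonempty (Φ.obj M' ≅ M) ∧
        Nonempty (Φ.obj N' ≅ N) := by
  obtain ⟨T, hT', ⟨e⟩⟩ := Φ.mem_mapTriangle_essImage_of_distinguished _ hT
  exact ⟨T.obj₁, T.obj₃, _, _, _, dist_of_iso₂ (f := T.mor₁) (g := T.mor₂) (δ := T.mor₃) hT'
    (Φ.preimageIso (Triangle.π₂.mapIso e)), ⟨Triangle.π₁.mapIso e⟩, ⟨Triangle.π₃.mapIso e⟩⟩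

/-- The t-structure on `C` whose aisles are the inverse images of those of `t` under `Φ`. -/
def pullbackTStructure (t : TStructure D) : TStructure C where
  le n := (t.le n).inverseImage Φ
  ge n := (t.ge n).inverseImage Φ
  le_shift n a n' h X hX :=
    (t.le n').prop_of_iso ((Φ.commShiftIso a).symm.app X) (t.le_shift n a n' h _ hX)
  ge_shift n a n' h X hX :=
    (t.ge n').prop_of_iso ((Φ.commShiftIso a).symm.app X) (t.ge_shift n a n' h _ hX)
  zero' X Y f hX hY := Φ.map_injective (by rw [Φ.map_zero]; exact t.zero' _ hX hY)
  le_zero_le X hX := t.le_zero_le _ hX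
  ge_one_le X hX := t.ge_one_le _ hX
  exists_triangle_zero_one A := by
    obtain ⟨X, Y, hX, hY, f, g, δ, hT⟩ := t.exists_triangle_zero_one (Φ.obj A)
    obtain ⟨X', Y', f', g', δ', hT', ⟨e⟩, ⟨e'⟩⟩ := exists_dist_of_dist_obj Φ hT
    exact ⟨X', Y', (t.le 0).prop_of_iso e.symm hX, (t.ge 1).prop_of_iso e'.symm hY, f', g', δ', hT'⟩

variable {t : TStructure D}

theorem inDeg_pullback_iff (n : ℤ) (X : C) :
    InDeg (pullbackTStructure Φ t) n X ↔ InDeg t n (Φ.obj X) := by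
  simp only [InDeg, ← TStructure.le_iff_isLE, ← TStructure.ge_iff_isGE]
  rfl

theorem isZero_obj_functor_iff (X : C) : IsZero (Φ.obj X) ↔ IsZero X := by
  rw [IsZero.iff_id_eq_zero, IsZero.iff_id_eq_zero, ← Φ.map_id, Φ.map_eq_zero_iff]

theorem semistableFor_pullback_iff {R : Type} [AddCommGroup R] {ω : K0 D →+ K0 D →+ R}
    {ω' : K0 C →+ K0 C →+ R} {P : R → Prop}
    (hω : ∀ M N, ω' (K0.mk M) (K0.mk N) = ω (K0.mk (Φ.obj M)) (K0.mk (Φ.obj N))) (n : ℤ) (E : C) :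
    SemistableFor (pullbackTStructure Φ t) ω' P n E ↔ SemistableFor t ω P n (Φ.obj E) := by
  unfold SemistableFor
  simp only [inDeg_pullback_iff, isZero_obj_functor_iff]
  refine and_congr_right fun _ => and_congr_right fun _ => ⟨fun h => ?_, fun h => ?_⟩
  · intro M N f g δ hT hM hN hM0 hN0
    obtain ⟨M', N', f', g', δ', hT', ⟨e⟩, ⟨e'⟩⟩ := exists_dist_of_dist_obj Φ hT
    rw [← K0.mk_eq_of_iso e, ← K0.mk_eq_of_iso e', ← hω]
    exact h f' g' δ' hT' (hM.of_iso e.symm) (hN.of_iso e'.symm)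
      (fun h0 => hM0 (((isZero_obj_functor_iff Φ M').2 h0).of_iso e.symm))
      (fun h0 => hN0 (((isZero_obj_functor_iff Φ N').2 h0).of_iso e'.symm))
  · intro M N f g δ hT hM hN hM0 hN0
    rw [hω]
    exact h _ _ _ (Φ.map_distinguished _ hT) hM hN
      (fun h0 => hM0 ((isZero_obj_functor_iff Φ M).1 h0))
      (fun h0 => hN0 ((isZero_obj_functor_iff Φ N).1 h0))

end Pullback

/-! ### Slicings -/

theorem phase_congr {C : Type w₂} [Category.{w₁} C] [Preadditive C] [HasZeroObject C]
    [HasShift C ℤ] [∀ n : ℤ, (shiftFunctor C n).Additive] [Pretriangulated C]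
    {D : Type w₄} [Category.{w₃} D] [Preadditive D] [HasZeroObject D] [HasShift D ℤ]
    [∀ n : ℤ, (shiftFunctor D n).Additive] [Pretriangulated D]
    {Z : K0 C →+ ConvLaurent ℂ} {Z' : K0 D →+ ConvLaurent ℂ} {E : C} {F : D}
    (h : Z (K0.mk E) = Z' (K0.mk F)) (a : PhaseFn) : phase Z a E = phase Z' a F := by
  rw [phase, phase, h]

section Slicing

variable {C : Type w₂} [Category.{w₁} C] [Preadditive C] [HasZeroObject C] [HasShift C ℤ]
  [∀ n : ℤ, (shiftFunctor C n).Additive] [Pretriangulated C] [IsTriangulated C]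
  {t t' : TStructure C} {Z : K0 C →+ ConvLaurent ℂ} {a c : PhaseFn}

theorem slicing_iff (hZ : IsPolyStabFun t Z a) (φ : PhaseFn) (E : C) :
    slicing t Z a φ E ↔ IsZero E ∨ ∃ j : ℤ, SemistableFor t (pairing Z) (0 ≤ ·) j E ∧
      phase Z a (E⟦j⟧) = (φ : RealGerm) + ((j : ℝ) : RealGerm) := by
  refine or_congr_right (exists_congr fun j => ⟨fun ⟨h, hs, hp⟩ => ⟨?_, hp⟩,
    fun ⟨hs, hp⟩ => ⟨(heart_shift_iff t E j).2 hs.1, ?_, hp⟩⟩)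
  · exact (semistableFor_shift_iff E j j 0 (add_zero j)).1 ((isSemistableInHeart_iff hZ _).1 hs)
  · exact (isSemistableInHeart_iff hZ _).2 ((semistableFor_shift_iff E j j 0 (add_zero j)).2 hs)

theorem slicing_of_iso (hZ : IsPolyStabFun t Z a) {φ : PhaseFn} {E F : C}
    (h : slicing t Z a φ E) (e : E ≅ F) : slicing t Z a φ F := by
  rw [slicing_iff hZ] at h ⊢
  rcases h with h | ⟨j, hs, hp⟩
  · exact Or.inl (h.of_iso e.symm)
  · refine Or.inr ⟨j, hs.of_iso e, ?_⟩
    rw [← hp]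
    exact phase_congr (congrArg Z (K0.mk_eq_of_iso ((shiftFunctor C j).mapIso e.symm))) a

omit [IsTriangulated C] in
theorem phase_shift_add_of_inDeg (hZ : IsPolyStabFun t Z a) (hZ' : IsPolyStabFun t' Z c)
    (hac : (a : RealGerm) ≺ c) (hca : (c : RealGerm) ≺ (a : RealGerm) + 1)
    {i j : ℤ} (hi : i = 0 ∨ i = 1) {E : C} (hE : InDeg t j E) (hE' : InDeg t' (j + i) E)
    (hE0 : ¬ IsZero E) :
    phase Z c (E⟦j + i⟧) = phase Z a (E⟦j⟧) + ((i : ℝ) : RealGerm) := by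
  rw [← phase_shift_of_inDeg hZ hZ' hac hca hi ((heart_shift_iff t E j).2 hE)
    ((inDeg_shift_iff t' E (j + i) j i rfl).2 hE') fun h => hE0 ((isZero_shift_iff _ _).1 h)]
  exact phase_congr (congrArg Z (K0.mk_eq_of_iso ((shiftFunctorAdd C j i).app E))) c

theorem germ_add_intCast_add (φ : RealGerm) (j i : ℤ) :
    φ + ((j : ℝ) : RealGerm) + ((i : ℝ) : RealGerm) = φ + (((j + i : ℤ) : ℝ) : RealGerm) := by
  obtain ⟨f, rfl⟩ := exists_rep φ
  refine Germ.coe_eq.2 (Eventually.of_forall fun v => ?_)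
  change f v + j + i = f v + ((j + i : ℤ) : ℝ)
  push_cast
  ring

/-- If `E[j]` is semistable in the first heart, then `E[j + i]` is semistable in the second for some
`i ∈ {0, 1}`, with phase larger by `i`. The normalized phase, obtained by subtracting the shift, is
therefore the same. -/
theorem slicing_tilt_iff (hZ : IsPolyStabFun t Z a) (hZ' : IsPolyStabFun t' Z c)
    (hac : (a : RealGerm) ≺ c) (hca : (c : RealGerm) ≺ (a : RealGerm) + 1)
    (ht : IsBoundedTStructure t) (h : IsTilt t t' 0) (φ : PhaseFn) (E : C) :
    slicing t Z a φ E ↔ slicing t' Z c φ E := by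
  have h' := h.symm ht
  have hpos := isPositive_pairing hZ hZ' hac hca
  have hω := pairing_self Z
  rw [slicing_iff hZ, slicing_iff hZ']
  refine or_congr_right ?_
  have key : ∀ j, SemistableFor t (pairing Z) (0 ≤ ·) j E → ∃ i : ℤ,
      SemistableFor t' (pairing Z) (0 ≤ ·) (j + i) E ∧
        phase Z c (E⟦j + i⟧) = phase Z a (E⟦j⟧) + ((i : ℝ) : RealGerm) := by
    intro j hs
    rcases hs.inDeg_or h h' hpos (fun _ => id) with hE | hE
    · have hs' := hs.tilt_left h h' hpos hω (fun _ => id) (fun _ => le_of_lt) hE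
      exact ⟨0, hs', phase_shift_add_of_inDeg hZ hZ' hac hca (Or.inl rfl) hs.1 hE hs.2.1⟩
    · have hs' := hs.tilt_right h h' hpos hω (fun _ => id) (fun _ => le_of_lt) hE
      rw [add_zero] at hE hs'
      exact ⟨1, hs', phase_shift_add_of_inDeg hZ hZ' hac hca (Or.inr rfl) hs.1 hE hs.2.1⟩
  constructor
  · rintro ⟨j, hs, hp⟩
    obtain ⟨i, hs', hp'⟩ := key j hs
    exact ⟨j + i, hs', by rw [hp', hp, germ_add_intCast_add]⟩
  · rintro ⟨k, hs, hp⟩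
    obtain ⟨j, hj⟩ := (exists_semistableFor_iff h ht hpos hω (fun _ => id)
      (fun _ => le_of_lt) E).2 ⟨k, hs⟩
    obtain ⟨i, hs', hp'⟩ := key j hj
    -- A nonzero object lies in only one shift of a heart, so the degree reached from `j` must be
    -- `k`.
    obtain rfl : j + i = k := hs'.1.eq_of_not_isZero hs.1 hs.2.1
    refine ⟨j, hj, ?_⟩
    rw [hp, ← germ_add_intCast_add] at hp'
    exact (add_right_cancel hp').symm

end Slicing

end PolyStab

end

/-! ### The theorem -/

theorem theorem5p5
    {D : Type*} [Category* D] [Preadditive D] [HasZeroObject D] [HasShift D ℤ]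
    [∀ n : ℤ, (shiftFunctor D n).Additive] [Pretriangulated D] [IsTriangulated D]
    {U : Type*} [Category* U] [Preadditive U] [HasZeroObject U] [HasShift U ℤ]
    [∀ n : ℤ, (shiftFunctor U n).Additive] [Pretriangulated U] [IsTriangulated U]
    (Φ : D ⥤ U) [Φ.CommShift ℤ] [Φ.IsTriangulated] [Φ.IsEquivalence]
    (Ψ : U ⥤ D) [Ψ.CommShift ℤ] [Ψ.IsTriangulated] [Ψ.IsEquivalence]
    (hΨΦ : Nonempty (Φ ⋙ Ψ ≅ shiftFunctor D (-1 : ℤ)))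
    (hΦΨ : Nonempty (Ψ ⋙ Φ ≅ shiftFunctor U (-1 : ℤ)))
    (tA : TStructure D) (tB : TStructure U) (hA : IsBoundedTStructure tA) (hB : IsBoundedTStructure tB)
    (hΦ : ∀ E : D, tA.heart E → tB.IsGE (Φ.obj E) 0 ∧ tB.IsLE (Φ.obj E) 1)
    (a b : PhaseFn) (ZA : K0 D →+ ConvLaurent ℂ) (ZB : K0 U →+ ConvLaurent ℂ)
    (hZA : IsPolyStabFun tA ZA a) (hZB : IsPolyStabFun tB ZB b)
    (T : GL (Fin 2) (ConvLaurent ℝ)) (hT : T ∈ GLPlus)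
    (hZ : ∀ E : D, ZB (K0.mk (Φ.obj E)) =
      matAct (T : Matrix (Fin 2) (Fin 2) (ConvLaurent ℝ)) (ZA (K0.mk E)))
    (p : LiftedPath T)
    (hab : (a : RealGerm) ≺ p.Γ.symm b) (hba : (p.Γ.symm b : RealGerm) ≺ (a : RealGerm) + 1) :
    -- phases of the WIT objects
    ((∀ E : D, tA.heart E → ¬ IsZero E → IsWIT tB Φ 0 E →
        (p.Γ.symm b : RealGerm) ≺ phase ZA a E) ∧
      (∀ F : D, tA.heart F → ¬ IsZero F → IsWIT tB Φ 1 F →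
        phase ZA a F ≤ (p.Γ.symm b : RealGerm))) ∧
    -- semistable objects are WIT
    (∀ E : HeartCat tA, IsSemistableInHeart tA ZA a E →
      IsWIT tB Φ 0 E.obj ∨ IsWIT tB Φ 1 E.obj) ∧
    -- refinement of the weight functions; `u` is the element `e^{iπ(-a)}` of `ℂ((1/v))ᶜ`
    (IsTorsionPair (W tA tB Φ 0) (W tA tB Φ 1) ∧
      ∃ u : ConvLaurent ℂ,
        evGerm u = (a : RealGerm).map
          (fun x : ℝ => Complex.exp (Real.pi * (-x : ℝ) * Complex.I)) ∧
        ∀ M : HeartCat tA, ¬ IsZero M →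
          (IsWIT tB Φ 0 M.obj →
            Refinement0 tA (weight ((AddMonoidHom.mulLeft u).comp ZA) M.obj)
              (W tA tB Φ 0) (W tA tB Φ 1)) ∧
          (IsWIT tB Φ 1 M.obj →
            Refinement1 tA (weight ((AddMonoidHom.mulLeft u).comp ZA) M.obj)
              (W tA tB Φ 0) (W tA tB Φ 1))) ∧
    -- correspondence of (semi)stable objects
    (∀ E : D, tA.heart E → ¬ IsZero E →
      (IsSemistable tA ZA a E ↔ IsSemistable tB ZB b (Φ.obj E)) ∧
      (IsStable tA ZA a E ↔ IsStable tB ZB b (Φ.obj E))) ∧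
    -- the equality of polynomial stability conditions
    (HasHN tA ZA a → HasHN tB ZB b →
      ((stabPair tA ZA a).actEquiv Φ).IsPolyStabCond ∧
      (stabPair tA ZA a).actEquiv Φ = (stabPair tB ZB b).actPath p) := by
  have hZ' := p.isPolyStabFun_charge hZB
  set c : PhaseFn := p.Γ.symm b with hc
  -- With `T⁻¹ Z_B` in place of `Z_B`, the equivalence `Φ` preserves central charges.
  have hcharge : ∀ E : D, ZA (K0.mk E) = p.charge ZB (K0.mk (Φ.obj E)) := fun E => by
    rw [AddMonoidHom.comp_apply, hZ, ← matAct_mul, ← Units.val_mul, inv_mul_cancel,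
      Units.val_one, matAct_one]
  have hpair : ∀ M N : D, pairing ZA (K0.mk M) (K0.mk N) =
      pairing (p.charge ZB) (K0.mk (Φ.obj M)) (K0.mk (Φ.obj N)) := fun M N => by
    rw [pairing_apply, pairing_apply, hcharge, hcharge]
  -- With this t-structure, being WIT`ᵢ` means lying in `t'`-degree `i`, and the hypothesis on `Φ`
  -- says that `tA` and `t'` form a tilt with `p = 0`.
  let t' : TStructure D := pullbackTStructure Φ tB
  have ht' : ∀ n X, InDeg t' n X ↔ InDeg tB n (Φ.obj X) := inDeg_pullback_iff Φ
  have hZc : IsPolyStabFun t' ZA c := fun E hE hE0 => by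
    rw [hcharge]
    exact hZ' _ hE fun h => hE0 ((isZero_obj_functor_iff Φ E).1 h)
  have htilt : IsTilt tA t' 0 := isTilt_of_heart fun X hX => ⟨⟨(hΦ X hX).1.ge⟩, ⟨(hΦ X hX).2.le⟩⟩
  have htilt' := htilt.symm hA
  have hpos := isPositive_pairing hZA hZc hab hba
  have hω := pairing_self ZA
  have hwit : ∀ (i : ℤ) (E : D), IsWIT tB Φ i E ↔ InDeg t' i E := fun i E =>
    (heart_shift_iff tB (Φ.obj E) i).trans (ht' i E).symm
  have hW : ∀ (i : ℤ) (E : HeartCat tA), W tA tB Φ i E ↔ InDeg t' i E.obj := fun i E =>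
    hwit i E.obj
  have hslice : ∀ (φ : PhaseFn) (E : D),
      slicing tA ZA a φ E ↔ slicing tB (p.charge ZB) c φ (Φ.obj E) := fun φ E => by
    rw [slicing_tilt_iff hZA hZc hab hba hA htilt, slicing_iff hZc, slicing_iff hZ',
      isZero_obj_functor_iff]
    -- The pullback matches semistability; the phases agree because `Φ` preserves charges and
    -- commutes with shifts.
    refine or_congr_right (exists_congr fun j => ?_)
    rw [semistableFor_pullback_iff Φ hpair, phase_congr (Z' := p.charge ZB) (F := (Φ.obj E)⟦j⟧)]
    rw [hcharge]
    exact congrArg _ (K0.mk_eq_of_iso ((Φ.commShiftIso j).app E))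
  refine ⟨⟨fun E hE hE0 hE1 => ?_, fun F hF hF0 hF1 => ?_⟩, fun E hE => ?_, ⟨?_, ?_⟩,
    fun E hE hE0 => ⟨?_, ?_⟩, fun _ hHN => ?_⟩
  · exact prec_phase_of_inDeg_zero hZA hZc hab hba hE ((hwit 0 E).1 hE1) hE0
  · exact phase_le_of_inDeg_one hZA hZc hab hba hF ((hwit 1 F).1 hF1) hF0
  · rw [hwit, hwit]
    exact ((isSemistableInHeart_iff hZA E).1 hE).inDeg_or htilt htilt' hpos fun _ => id
  · exact isTorsionPair_of_isTilt htilt htilt' (hW 0) (hW 1)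
  · obtain ⟨u, hu⟩ := exists_normalization a
    have hnorm : ∀ᶠ v in atTop, ‖ev u v‖ = 1 := by
      obtain ⟨α, hα⟩ := exists_rep a
      rw [← hα] at hu
      filter_upwards [Germ.coe_eq.1 hu] with v hv
      rw [hv, Function.comp_apply, ← Complex.ofReal_mul, Complex.norm_exp_ofReal_mul_I]
    have hweight : ∀ M E : D, weight ((AddMonoidHom.mulLeft u).comp ZA) M (K0.mk E) =
        pairing ZA (K0.mk M) (K0.mk E) := fun M E => by
      rw [weight_apply, pairing_apply]
      exact cross_mul_left_of_norm_one hnorm _ _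
    have hlt : ∀ X Y : HeartCat tA, InDeg t' 0 X.obj → ¬ IsZero X → InDeg t' 1 Y.obj →
        ¬ IsZero Y → 0 < pairing ZA (K0.mk Y.obj) (K0.mk X.obj) := fun X Y hX hX0 hY hY0 =>
      pairing_pos_of_inDeg hZA hZc hab hba X.property hX (fun h => hX0 ((isZero_obj_iff tA X).1 h))
        Y.property hY (fun h => hY0 ((isZero_obj_iff tA Y).1 h))
    refine ⟨u, hu, fun M hM => ⟨fun hM0 => ?_, fun hM1 => ?_⟩⟩
    · refine refinement0_of_isTilt htilt htilt' (hW 0) (hW 1) fun G hG hG0 => ?_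
      rw [hweight, pairing_swap hω]
      exact neg_neg_of_pos (hlt M G ((hW 0 M).1 hM0) hM ((hW 1 G).1 hG) hG0)
    · refine refinement1_of_isTilt htilt htilt' (hW 0) (hW 1) fun G hG hG0 => ?_
      rw [hweight]
      exact hlt G M ((hW 0 G).1 hG) hG0 ((hW 1 M).1 hM1) hM
  -- Three comparisons: from `Z_B` to `T⁻¹ Z_B` on `B`, from `A` to `A'` by tilting, and from `A'`
  -- to `B` along `Φ`.
  · rw [← p.isSemistable_charge_iff hZB, isSemistable_iff hZA, isSemistable_iff hZ',
      exists_semistableFor_iff htilt hA hpos hω (fun _ => id) (fun _ => le_of_lt)]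
    exact exists_congr fun n => semistableFor_pullback_iff Φ hpair n E
  · rw [← p.isStable_charge_iff hZB, isStable_iff hZA, isStable_iff hZ',
      exists_semistableFor_iff htilt hA hpos hω (fun _ => le_of_lt) (fun _ => id)]
    exact exists_congr fun n => semistableFor_pullback_iff Φ hpair n E
  -- Both sides are identified with the pair of `T⁻¹ Z_B` on the heart of `tB`, whose HN property is
  -- inherited from `Z_B`.
  · have hact : (stabPair tB ZB b).actPath p = stabPair tB (p.charge ZB) c := by
      refine StabPair.ext rfl (funext fun φ => ?_)
      ext F
      exact (p.slicing_charge_iff hZB φ F).symm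
    have heq : (stabPair tA ZA a).actEquiv Φ = stabPair tB (p.charge ZB) c := by
      refine StabPair.ext ?_ (funext fun φ => ?_)
      · change ZA.comp (K0.mapEquiv Φ).symm.toAddMonoidHom = p.charge ZB
        have h : ∀ x, ZA x = p.charge ZB (K0.map Φ x) := DFunLike.congr_fun
          (K0.hom_ext (g := (p.charge ZB).comp (K0.map Φ)) fun E => by
            rw [AddMonoidHom.comp_apply, K0.map_mk]; exact hcharge E)
        refine AddMonoidHom.ext fun y => ?_
        obtain ⟨x, rfl⟩ := (K0.mapEquiv Φ).surjective y
        change ZA ((K0.mapEquiv Φ).symm (K0.mapEquiv Φ x)) = _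
        rw [AddEquiv.symm_apply_apply]
        exact h x
      · ext F
        constructor
        · rintro ⟨E, hE, ⟨e⟩⟩
          exact slicing_of_iso hZ' ((hslice φ E).1 hE) e
        · intro hF
          exact ⟨Φ.objPreimage F, (hslice φ _).2
            (slicing_of_iso hZ' hF (Φ.objObjPreimageIso F).symm), ⟨Φ.objObjPreimageIso F⟩⟩
    rw [hact, heq]
    exact ⟨⟨tB, c, hB, hZ', p.hasHN_charge hZB hHN, rfl⟩, rfl⟩
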